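/- **Theorem 1.8.** Let $(M^n,g)$, $n\ge 3$, be a compact connected Riemannian manifold (without boundary) with $\mathrm{Ric}=2\mu g$ for a constant $\mu>0$, let $\phi=c$ be a constant function, and let $\lambda=0$. *Notation.* For $(M,g,\phi)$ with $\lambda=0$, a normal weighted ambient space is a smooth family $(g_u,\phi_u)$, $u$ in an open interval $I\ni 0$, with $(g_0,\phi_0)=(g,\phi)$, such that for $\widetilde g=2\,du\,dv+g_u$ and $\widetilde\phi=\phi_u-v$ on $\mathbb R\times M\times I$ the tensor $\widetilde{\mathrm{Ric}}+\widetilde\nabla^2\widetilde\phi$ and the function $\widetilde\Delta\widetilde\phi-|\widetilde\nabla\widetilde\phi|^2$ are $O(u^\infty)$ at $u=0$; it is global if both vanish identically. Put $$v_{k,\phi}=\frac1{k!}\,\partial_u^k\Big|_{u=0}\,\frac{e^{-\phi_u}}{e^{-\phi}}\Big(\frac{\det g_u}{\det g}\Big)^{1/2},\qquad \mathcal F_{k,\phi}=\int_M v_{k,\phi}\,e^{-\phi}\,\mathrm{dvol}_g .$$ The gradient Ricci flow is $\partial_t g=-2(\mathrm{Ric}+\nabla^2\phi)$, $\partial_t\phi=-R-\Delta\phi$.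 *The flow.* There is a global normal weighted ambient space for $(M,g,c)$ with $I=(-\frac1{4\mu},\infty)$ that is real-analytic in $u$ and on which the integral curves below exist. For every normal weighted ambient space for $(M,g,c)$ that is real-analytic in $u$, on an open interval $I\ni0$, one has $1+4\mu u>0$ on $I$ and $$g_u=(1+4\mu u)\,g,\qquad \phi_u=\tfrac n4\ln|1+4\mu u|+c .$$ Along the integral curves of $X=v_{1,\phi}\,\partial_v-\partial_u$ that start at $u=v=0$ at time $t=0$, where $v_{1,\phi}=\frac12(R+2\Delta\phi-|\nabla\phi|^2)$ is computed from $(g_u,\phi_u)$, the pair $(g_u,\widetilde\phi)$ is a solution $(g_t,\phi_t)$, $-t\in I$, of the gradient Ricci flow with initial value $(g,c)$. Each $(M,g_t,\phi_t)$ has a normal weighted ambient space, and any such space (not necessarily analytic) gives $$v_{k,\phi_t}=\frac1{k!}\Big(\frac{\mu}{1-4\mu t}\Big)^k\prod_{i=0}^{k-1}(n-4i)\qquad(k\ge 0).$$ *Monotonicity.* Along this flow, for $k\ge1$, $\mathcal F_{k,\phi}$ is strictly increasing in $t$, strictly decreasing in $t$, or identically $0$ according to whether $\prod_{i=0}^{k-1}(n-4i)$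 is positive, negative, or zero. Consequently, for every integer $j\ge 1$: 1. if $4(j-1)<n<4j$, then $\mathcal F_{k,\phi}$ is strictly increasing for $k\in\{1,\dots,j\}\cup\{j+2s : s\ge1\}$ and strictly decreasing for $k\in\{j+2s-1 : s\ge 1\}$; 2. if $n=4j$, then $\mathcal F_{k,\phi}$ is strictly increasing for $k\in\{1,\dots,j\}$ and identically $0$ for $k>j$. -/

import Mathlib

open scoped Manifold ContDiff

noncomputable section

namespace WeightedAmbient

/-! ### Pseudo-Riemannian geometry of a metric given in linear coordinates

`V` is a (finite-dimensional) coordinate space, `G : V → Bil V` the coordinate expression of a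
(possibly indefinite) metric, and `f : V → ℝ` the coordinate expression of a function. -/

/-- Continuous bilinear forms on `V`. -/
abbrev Bil (V : Type*) [NormedAddCommGroup V] [NormedSpace ℝ V] := V →L[ℝ] V →L[ℝ] ℝ

section Local

variable {V : Type*} [NormedAddCommGroup V] [NormedSpace ℝ V]

/-- The Christoffel symbols `Γ(X, Y)` of the Levi-Civita connection, that is, half of the image
of the covector `Z ↦ (∂_X G)(Y, Z) + (∂_Y G)(X, Z) - (∂_Z G)(X, Y)` under the musical isomorphism
`V* → V` inverse to `G x`. -/
def christoffel (G : V → Bil V) (x : V) : V →L[ℝ] V →L[ℝ] V :=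
  let D : V →L[ℝ] V →L[ℝ] V →L[ℝ] ℝ := fderiv ℝ G x
  let flip : (V →L[ℝ] V →L[ℝ] ℝ) →L[ℝ] (V →L[ℝ] V →L[ℝ] ℝ) :=
    (ContinuousLinearMap.flipₗᵢ ℝ V V ℝ).toContinuousLinearEquiv
  let sharp : (V →L[ℝ] V →L[ℝ] ℝ) →L[ℝ] (V →L[ℝ] V) :=
    ContinuousLinearMap.compL ℝ V (V →L[ℝ] ℝ) V (G x).inverse
  (2⁻¹ : ℝ) • (sharp.comp D + sharp.comp D.flip - sharp.comp (flip.comp D.flip))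

/-- The value of the Christoffel symbols, as in the textbook formula. -/
theorem christoffel_apply (G : V → Bil V) (x X Y : V) (θ : V →L[ℝ] ℝ)
    (hθ : ∀ Z, θ Z = fderiv ℝ G x X Y Z + fderiv ℝ G x Y X Z - fderiv ℝ G x Z X Y) :
    christoffel G x X Y = (2⁻¹ : ℝ) • (G x).inverse θ := by
  have h : θ = fderiv ℝ G x X Y + fderiv ℝ G x Y X - ((fderiv ℝ G x).flip X).flip Y := by
    ext Z; simp [hθ]
  rw [h]
  simp only [map_sub, map_add]
  rfl

/-- The endomorphism `X ↦ R(X, Y) Z`, where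
`R(X, Y) Z = (∂_X Γ)(Y, Z) - (∂_Y Γ)(X, Z) + Γ(X, Γ(Y, Z)) - Γ(Y, Γ(X, Z))`
is the curvature `∇_X ∇_Y Z - ∇_Y ∇_X Z - ∇_[X,Y] Z`. -/
def curvatureEnd (G : V → Bil V) (x Y Z : V) : V →L[ℝ] V :=
  (((fderiv ℝ (christoffel G) x).flip Y).flip Z) - (fderiv ℝ (christoffel G) x Y).flip Z
    + (christoffel G x).flip (christoffel G x Y Z)
    - (christoffel G x Y).comp ((christoffel G x).flip Z)

/-- The Ricci tensor `Ric(Y, Z) = tr (X ↦ R(X, Y) Z)`. -/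
def ricci (G : V → Bil V) (x : V) : V →ₗ[ℝ] V →ₗ[ℝ] ℝ :=
  LinearMap.mk₂ ℝ (fun Y Z => LinearMap.trace ℝ V (curvatureEnd G x Y Z : V →ₗ[ℝ] V))
    (fun Y Y' Z => by
      rw [← map_add]; congr 1; ext X; simp [curvatureEnd]; abel)
    (fun a Y Z => by
      rw [← map_smul]; congr 1; ext X; simp [curvatureEnd, smul_sub, smul_add])
    (fun Y Z Z' => by
      rw [← map_add]; congr 1; ext X; simp [curvatureEnd]; abel)
    (fun a Y Z => by
      rw [← map_smul]; congr 1; ext X; simp [curvatureEnd, smul_sub, smul_add])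

/-- The Hessian `(∇²f)(X, Y) = ∂_X ∂_Y f - df(Γ(X, Y))`. -/
def hessian (G : V → Bil V) (f : V → ℝ) (x : V) : V →ₗ[ℝ] V →ₗ[ℝ] ℝ :=
  LinearMap.mk₂ ℝ (fun X Y => fderiv ℝ (fderiv ℝ f) x X Y - fderiv ℝ f x (christoffel G x X Y))
    (fun X X' Y => by simp; ring)
    (fun a X Y => by simp; ring)
    (fun X Y Y' => by simp; ring)
    (fun a X Y => by simp; ring)

variable [FiniteDimensional ℝ V]

/-- The trace `G^{ij} T_{ij}` of a bilinear form `T` with respect to a nondegenerate form `b`. -/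
def metricTrace (b : Bil V) (T : V →ₗ[ℝ] V →ₗ[ℝ] ℝ) : ℝ :=
  LinearMap.trace ℝ V
    ((b.inverse : (V →L[ℝ] ℝ) →ₗ[ℝ] V) ∘ₗ
      (LinearMap.toContinuousLinearMap : (V →ₗ[ℝ] ℝ) ≃ₗ[ℝ] (V →L[ℝ] ℝ)).toLinearMap ∘ₗ T)

/-- The scalar curvature `R`. -/
def scalarCurvature (G : V → Bil V) (x : V) : ℝ := metricTrace (G x) (ricci G x)

/-- The Laplacian `Δf = tr ∇²f`. -/
def laplacian (G : V → Bil V) (f : V → ℝ) (x : V) : ℝ := metricTrace (G x) (hessian G f x)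

/-- The square norm `|∇f|² = df(∇f)` of the gradient. -/
def gradSq (G : V → Bil V) (f : V → ℝ) (x : V) : ℝ :=
  fderiv ℝ f x ((G x).inverse (fderiv ℝ f x))

/-- The Bakry–Émery Ricci tensor `Ric_φ = Ric + ∇²φ`; for `λ = 0` this is also `P_φ`. -/
def weightedRicci (G : V → Bil V) (f : V → ℝ) (x : V) : V →ₗ[ℝ] V →ₗ[ℝ] ℝ :=
  ricci G x + hessian G f x

/-- The scalar `F_φ = Δφ - |∇φ|²` (the case `λ = 0`). -/
def weightedF (G : V → Bil V) (f : V → ℝ) (x : V) : ℝ := laplacian G f x - gradSq G f x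

/-- The weighted scalar curvature `R_φ = R + 2Δφ - |∇φ|²` (the case `λ = 0`). -/
def weightedScalar (G : V → Bil V) (f : V → ℝ) (x : V) : ℝ :=
  scalarCurvature G x + 2 * laplacian G f x - gradSq G f x

end Local

/-! ### Riemannian metrics on a manifold, in charts -/

/-- The coordinate space of an `n`-manifold. -/
abbrev Euc (n : ℕ) := EuclideanSpace ℝ (Fin n)

/-- Smooth Riemannian metrics on the `n`-manifold `M`. -/
abbrev Metric (n : ℕ) (M : Type*) [TopologicalSpace M] [ChartedSpace (Euc n) M]
    [IsManifold (𝓡 n) ∞ M] :=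
  Bundle.ContMDiffRiemannianMetric (𝓡 n) ∞ (Euc n) (fun x : M => TangentSpace (𝓡 n) x)

section Manifold

variable {n : ℕ} {M : Type*} [TopologicalSpace M] [ChartedSpace (Euc n) M]
  [IsManifold (𝓡 n) ∞ M]

/-- The coordinate expression of `g` in the chart at `p`: the pullback of `g` by the inverse of
that chart. It is meaningful on the (open) target of the chart. -/
def coordMetric (g : Metric n M) (p : M) (y : Euc n) : Bil (Euc n) :=
  let A : Euc n →L[ℝ] TangentSpace (𝓡 n) ((extChartAt (𝓡 n) p).symm y) :=
    mfderiv 𝓘(ℝ, Euc n) (𝓡 n) (extChartAt (𝓡 n) p).symm y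
  (A.precomp ℝ).comp ((g.inner ((extChartAt (𝓡 n) p).symm y)).comp A)

/-- The coordinate expression of a function on `M` in the chart at `p`. -/
def coordFun (f : M → ℝ) (p : M) (y : Euc n) : ℝ := f ((extChartAt (𝓡 n) p).symm y)

/-- The determinant `det (g_ij)` in the chart at `p`. -/
def gramDet (g : Metric n M) (p : M) (y : Euc n) : ℝ :=
  Matrix.det (Matrix.of fun i j : Fin n =>
    coordMetric g p y (EuclideanSpace.single i 1) (EuclideanSpace.single j 1))

/-- `Ric = κ g`, as an identity of tensor fields: it holds in every chart. -/
def IsEinstein (g : Metric n M) (κ : ℝ) : Prop :=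
  ∀ p : M, ∀ y ∈ (extChartAt (𝓡 n) p).target, ∀ X Y : Euc n,
    ricci (coordMetric g p) y X Y = κ * coordMetric g p y X Y

/-- `(g_s, φ_s)`, `s ∈ J`, is a family of metric measure structures that is jointly smooth
on `M × J` (in every chart). -/
def IsSmoothFamily (J : Set ℝ) (g : ℝ → Metric n M) (φ : ℝ → M → ℝ) : Prop :=
  ∀ p : M,
    ContDiffOn ℝ ∞ (fun z : Euc n × ℝ => coordMetric (g z.2) p z.1)
      ((extChartAt (𝓡 n) p).target ×ˢ J) ∧
    ContDiffOn ℝ ∞ (fun z : Euc n × ℝ => coordFun (φ z.2) p z.1)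
      ((extChartAt (𝓡 n) p).target ×ˢ J)

/-- The gradient Ricci flow
`∂_t g = -2 (Ric + ∇²φ)`, `∂_t φ = -R - Δφ` for times `t ∈ J`. -/
def IsGradientRicciFlow (J : Set ℝ) (g : ℝ → Metric n M) (φ : ℝ → M → ℝ) : Prop :=
  IsSmoothFamily J g φ ∧
  ∀ t ∈ J, ∀ p : M, ∀ y ∈ (extChartAt (𝓡 n) p).target,
    (∀ X Y : Euc n, HasDerivAt (fun s => coordMetric (g s) p y X Y)
      (-2 * weightedRicci (coordMetric (g t) p) (coordFun (φ t) p) y X Y) t) ∧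
    HasDerivAt (fun s => coordFun (φ s) p y)
      (-scalarCurvature (coordMetric (g t) p) y
        - laplacian (coordMetric (g t) p) (coordFun (φ t) p) y) t

/-- The function `v_{1,φ} = R_φ / 2` of `(M, g, φ, λ = 0)`, computed in the chart at `x`. -/
def vOne (g : Metric n M) (φ : M → ℝ) (x : M) : ℝ :=
  (1 / 2) * weightedScalar (coordMetric g x) (coordFun φ x) (extChartAt (𝓡 n) x x)

/-! ### The Riemannian volume measure -/

section Volume

variable [T2Space M] [SigmaCompactSpace M]

variable (n M) in
/-- A smooth partition of unity, indexed by the points of `M`, whose member of index `p` is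
supported in the domain of the chart at `p`. -/
def chartPartition : SmoothPartitionOfUnity M (𝓡 n) M Set.univ :=
  Classical.choose (SmoothPartitionOfUnity.exists_isSubordinate_chartAt_source (𝓡 n) M)

variable (n M) in
theorem chartPartition_subordinate :
    (chartPartition n M).IsSubordinate (fun x => (chartAt (Euc n) x).source) :=
  Classical.choose_spec (SmoothPartitionOfUnity.exists_isSubordinate_chartAt_source (𝓡 n) M)

/-- The Riemannian volume measure `dvol_g`: with a partition of unity `(ρ_p)` subordinate to the
charts, the sum over `p` of the measures `ρ_p √(det g_ij) dy` transported to `M` by the charts. -/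
def riemannianVolume [MeasurableSpace M] (g : Metric n M) : MeasureTheory.Measure M :=
  MeasureTheory.Measure.sum fun p : M =>
    (((MeasureTheory.volume : MeasureTheory.Measure (Euc n)).restrict
        (extChartAt (𝓡 n) p).target).withDensity fun y =>
          ENNReal.ofReal
            (chartPartition n M p ((extChartAt (𝓡 n) p).symm y) * √(gramDet g p y))).map
      (extChartAt (𝓡 n) p).symm

end Volume

/-! ### Normal weighted ambient spaces -/

/-- The coordinate space of the ambient space; its points are written `(v, y, u)`. -/
abbrev Amb (n : ℕ) := ℝ × Euc n × ℝ

/-- The metric `2 du dv + g_u` on `ℝ × M × ℝ`, in the coordinates `(v, y, u)` given by the chart of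
`M` at `p`. -/
def ambientMetric (g : ℝ → Metric n M) (p : M) (z : Amb n) : Bil (Amb n) :=
  let dv : Amb n →L[ℝ] ℝ := ContinuousLinearMap.fst ℝ ℝ (Euc n × ℝ)
  let dy : Amb n →L[ℝ] Euc n :=
    (ContinuousLinearMap.fst ℝ (Euc n) ℝ).comp (ContinuousLinearMap.snd ℝ ℝ (Euc n × ℝ))
  let du : Amb n →L[ℝ] ℝ :=
    (ContinuousLinearMap.snd ℝ (Euc n) ℝ).comp (ContinuousLinearMap.snd ℝ ℝ (Euc n × ℝ))
  dv.smulRight du + du.smulRight dv + (coordMetric (g z.2.2) p z.2.1).bilinearComp dy dy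

/-- The function `φ_u - v` on `ℝ × M × ℝ`, in the same coordinates. -/
def ambientPotential (φ : ℝ → M → ℝ) (p : M) (z : Amb n) : ℝ :=
  coordFun (φ z.2.2) p z.2.1 - z.1

/-- The function `r` of `u` vanishes to infinite order at `u = 0`. -/
def VanishesToInfiniteOrder (r : ℝ → ℝ) : Prop :=
  ∀ m : ℕ, r =O[nhds 0] fun u => u ^ m

/-- A normal weighted ambient space for the manifold with density `(M, g, φ, λ = 0)`: a smooth
family `(g_u, φ_u)`, with `u` in an open interval `dom` containing `0` and `(g_0, φ_0) = (g, φ)`,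
such that for the Lorentzian metric `2 du dv + g_u` and the function `φ_u - v` on `ℝ × M × dom`
the tensor `Ric + ∇²φ` and the function `Δφ - |∇φ|²` are `O(u^∞)` at `u = 0`.
(The values of `metric` and `potential` outside `dom` carry no meaning.) -/
structure NormalAmbientSpace (g : Metric n M) (φ : M → ℝ) where
  /-- the interval of the coordinate `u` -/
  dom : Set ℝ
  isOpen_dom : IsOpen dom
  ordConnected_dom : dom.OrdConnected
  zero_mem_dom : (0 : ℝ) ∈ dom
  /-- the metrics `g_u` -/
  metric : ℝ → Metric n M
  /-- the functions `φ_u` -/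
  potential : ℝ → M → ℝ
  metric_zero : metric 0 = g
  potential_zero : potential 0 = φ
  smooth : IsSmoothFamily dom metric potential
  ricci_vanishes : ∀ p : M, ∀ y ∈ (extChartAt (𝓡 n) p).target, ∀ (v : ℝ) (ξ η : Amb n),
    VanishesToInfiniteOrder fun u =>
      weightedRicci (ambientMetric metric p) (ambientPotential potential p) (v, y, u) ξ η
  F_vanishes : ∀ p : M, ∀ y ∈ (extChartAt (𝓡 n) p).target, ∀ v : ℝ,
    VanishesToInfiniteOrder fun u =>
      weightedF (ambientMetric metric p) (ambientPotential potential p) (v, y, u)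

namespace NormalAmbientSpace

variable {g : Metric n M} {φ : M → ℝ}

/-- The ambient space is global: the ambient equations hold exactly on all of `ℝ × M × dom`. -/
def IsGlobal (A : NormalAmbientSpace g φ) : Prop :=
  ∀ p : M, ∀ y ∈ (extChartAt (𝓡 n) p).target, ∀ v : ℝ, ∀ u ∈ A.dom,
    (∀ ξ η : Amb n,
      weightedRicci (ambientMetric A.metric p) (ambientPotential A.potential p) (v, y, u) ξ η
        = 0) ∧
    weightedF (ambientMetric A.metric p) (ambientPotential A.potential p) (v, y, u) = 0

/-- At each point of `M`, `g_u` and `φ_u` are real-analytic functions of `u`. -/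
def IsAnalytic (A : NormalAmbientSpace g φ) : Prop :=
  ∀ x : M,
    (∀ X Y : TangentSpace (𝓡 n) x,
      AnalyticOnNhd ℝ (fun u => (A.metric u).inner x X Y) A.dom) ∧
    AnalyticOnNhd ℝ (fun u => A.potential u x) A.dom

/-- The renormalized volume
`v_φ = (e^{-φ̃} / e^{-φ}) (det g_u / det g)^{1/2}` on `v = 0`, at the point `x` of `M`. -/
def renormalizedVolume (A : NormalAmbientSpace g φ) (x : M) (u : ℝ) : ℝ :=
  Real.exp (-A.potential u x) / Real.exp (-φ x) *
    √(gramDet (A.metric u) x (extChartAt (𝓡 n) x x) / gramDet g x (extChartAt (𝓡 n) x x))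

/-- The renormalized volume coefficient `v_{k,φ} = (1 / k!) ∂_u^k v_φ` at `u = v = 0`. -/
def volumeCoeff (A : NormalAmbientSpace g φ) (k : ℕ) (x : M) : ℝ :=
  iteratedDeriv k (A.renormalizedVolume x) 0 / (Nat.factorial k : ℝ)

/-- The functional `𝓕_{k,φ} = ∫_M v_{k,φ} e^{-φ} dvol_g`. -/
def functional [T2Space M] [SigmaCompactSpace M] [MeasurableSpace M]
    (A : NormalAmbientSpace g φ) (k : ℕ) : ℝ :=
  ∫ x, A.volumeCoeff k x * Real.exp (-φ x) ∂(riemannianVolume g)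

/-! The vector field `X = v_{1,φ} ∂_v - ∂_u` on `ℝ × M × dom`, where `v_{1,φ}` is that of
`(M, g_u, φ_u)`, has the integral curves `t ↦ (w t x, x, -t)`; the structure
`(g_u, φ_u - v)` along the one with `w 0 x = 0` is `(g_{-t}, φ_{-t} - w t)`. -/

/-- The times for which the curves `t ↦ (w t x, x, -t)` stay in the ambient space. -/
def times (A : NormalAmbientSpace g φ) : Set ℝ := {t | -t ∈ A.dom}

/-- For every `x`, the curve `t ↦ (w t x, x, -t)`, `t ∈ A.times`, is the integral curve of
`X = v_{1,φ} ∂_v - ∂_u` that starts at `(0, x, 0)`. -/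
def IsIntegralFlow (A : NormalAmbientSpace g φ) (w : ℝ → M → ℝ) : Prop :=
  (∀ x, w 0 x = 0) ∧
  ∀ t ∈ A.times, ∀ x,
    HasDerivAt (fun s => w s x) (vOne (A.metric (-t)) (A.potential (-t)) x) t

/-- The metric along the integral curves of `X`. -/
def flowMetric (A : NormalAmbientSpace g φ) (t : ℝ) : Metric n M := A.metric (-t)

/-- The function `φ_u - v` along the integral curves of `X`. -/
def flowPotential (A : NormalAmbientSpace g φ) (w : ℝ → M → ℝ) (t : ℝ) (x : M) : ℝ :=
  A.potential (-t) x - w t x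

end NormalAmbientSpace

end Manifold

end WeightedAmbient

end

open WeightedAmbient

/-! Put `κ = 4μ`, so that `Ric(g) = (κ/2) g`. For a metric `2 du dv + g_u` and potential `φ_u - v`,
the `M`-block of the ambient tensor is `Ric(g_u) + ∇²φ_u - ½ ∂_u g_u`, and the ambient scalar is
`tr(∇²φ_u - ½ ∂_u g_u) - |∇φ_u|² + 2 ∂_u φ_u` (`weightedRicci_warped_mid`, `weightedF_warped`). The
ambient equations are thus a gradient Ricci flow run backwards in `u`, up to the gauge carried by
`v`.

Existence: constant rescaling leaves the Ricci tensor unchanged, so for constant potentials the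
first equation reads `∂_u g_u = κ g`. Hence `g_u = (1 + κu) g`, and the trace equation then forces
`∂_u φ_u = nκ / (4(1 + κu))`. The remaining `du²` component vanishes because the Ricci term cancels
`φ_u''` (`ambient_equations_of_einstein`).

Uniqueness: the two equations express `∂_u g_u` and then `∂_u φ_u` through spatial derivatives of
order at most two. If two solutions agree to order `u ^ m` at every point, so do their spatial
derivatives, and integrating in `u` gains one order (`fderiv_param_isBigO_pow`,
`ambient_jet_unique`). Agreement to infinite order fixes every `v_k`, since these are Taylor
coefficients at `0`; under analyticity it gives equality on the whole interval. There positive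
definiteness of `g_u` forces `1 + κu > 0`.

Flow and functionals: `v_1 = R/2` is constant on each slice, so the integral curves are explicit and
the flow is `((1 - κt) g, (n/2) log(1 - κt) + c)`. Each time slice is again Einstein with constant
potential, with `κ` replaced by `κ/(1 - κt)`. Its renormalized volume is `(1 + κu/(1 - κt))^(n/4)`,
whose Taylor coefficients give `v_k`. The measure `e^{-φ_t} dvol` does not change with `t`, so `𝓕_k`
is a positive constant times `∏ (n - 4i)` times `(κ/(4(1 - κt)))^k`. The last factor is strictly
increasing, and the sign of the product decides. -/

namespace WeightedAmbient

open Filter Asymptotics Topology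

/-! ### Orders of vanishing and Taylor coefficients at `u = 0` -/

section Jets

theorem natCast_le_infty (k : ℕ) : (k : ℕ∞ω) ≤ ∞ := by exact_mod_cast le_top

variable {E W W' : Type*} [NormedAddCommGroup E] [NormedSpace ℝ E]
  [NormedAddCommGroup W] [NormedSpace ℝ W] [NormedAddCommGroup W'] [NormedSpace ℝ W']

/-- Mean value inequality on the ball of radius `|u|`: integration gains one order. -/
theorem isBigO_pow_succ_of_deriv {f : ℝ → W} {m : ℕ} (hf : ∀ᶠ u in 𝓝 0, DifferentiableAt ℝ f u)
    (h0 : f 0 = 0) (h : deriv f =O[𝓝 0] fun u : ℝ => u ^ m) :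
    f =O[𝓝 0] fun u : ℝ => u ^ (m + 1) := by
  obtain ⟨C, hC⟩ := h.bound
  obtain ⟨ε, hε, hb⟩ := Metric.eventually_nhds_iff_ball.1 (hf.and hC)
  refine IsBigO.of_bound C ?_
  filter_upwards [Metric.ball_mem_nhds (0 : ℝ) hε] with u hu
  have hu' : |u| < ε := by simpa using hu
  have key := Convex.norm_image_sub_le_of_norm_deriv_le (f := f) (s := Metric.closedBall 0 |u|)
    (C := C * |u| ^ m) (x := 0) (y := u) ?_ ?_ (convex_closedBall _ _) (by simp) (by simp)
  · rw [h0] at key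
    simpa [pow_succ, mul_assoc] using key
  · intro x hx
    exact (hb x (by simp at hx ⊢; linarith)).1
  · intro x hx
    have hx' : |x| ≤ |u| := by simpa using hx
    have h1 := (hb x (by simp; linarith)).2
    -- The constant supplied by the `O`-bound is not known to be nonnegative. If it is negative then
    -- `x ^ m = 0`, the derivative vanishes at `x`, and the bound at `u` itself finishes.
    have hC0 : 0 ≤ C ∨ x ^ m = 0 := by
      by_contra hcon
      push Not at hcon
      have : 0 < ‖x ^ m‖ := norm_pos_iff.2 hcon.2
      nlinarith [norm_nonneg (deriv f x)]
    rcases hC0 with hC0 | hx0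
    · refine h1.trans ?_
      rw [norm_pow, Real.norm_eq_abs]
      gcongr
    · rw [hx0] at h1
      simp only [norm_zero, mul_zero] at h1
      have h2 := (hb u (by simpa using hu')).2
      rw [norm_pow, Real.norm_eq_abs] at h2
      exact h1.trans ((norm_nonneg _).trans h2)

theorem isBigO_pow_of_iteratedDeriv_eq_zero {f : ℝ → W} {m : ℕ} (hf : ContDiffAt ℝ ∞ f 0)
    (h : ∀ j < m, iteratedDeriv j f 0 = 0) : f =O[𝓝 0] fun u : ℝ => u ^ m := by
  induction m generalizing f with
  | zero => simpa using hf.continuousAt.isBigO_one ℝ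
  | succ m ih =>
    refine isBigO_pow_succ_of_deriv ?_ (by simpa using h 0 (by omega)) (ih ?_ ?_)
    · exact ((hf.of_le (m := 1) (by simp)).eventually (by simp)).mono
        fun u hu => hu.differentiableAt (by simp)
    · exact ContDiffAt.derivWithin hf (by simp)
    · intro j hj
      have := h (j + 1) (by omega)
      rwa [iteratedDeriv_succ'] at this

/-- Strong induction on `j`: once the lower derivatives vanish, `f` equals its degree `j` monomial
up to `O(u ^ (j + 1))`. As `j < m`, that monomial is itself `o(u ^ j)`, so its coefficient is zero.
-/
theorem iteratedDeriv_eq_zero_of_isBigO_pow {f : ℝ → W} {m : ℕ} (hf : ContDiffAt ℝ ∞ f 0)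
    (h : f =O[𝓝 0] fun u : ℝ => u ^ m) : ∀ j < m, iteratedDeriv j f 0 = 0 := by
  intro j
  induction j using Nat.strong_induction_on with
  | _ j ih =>
  intro hj
  set c := iteratedDeriv j f 0 with hc
  set p : ℝ → W := fun u => (u ^ j) • ((j.factorial : ℝ)⁻¹ • c) with hp
  have hpow : ContDiff ℝ ∞ fun u : ℝ => u ^ j := by fun_prop
  have hpC : ContDiff ℝ ∞ p := by fun_prop
  have hpd (i : ℕ) : iteratedDeriv i p 0 = if i = j then c else 0 := by
    rw [hp, iteratedDeriv_smul_const (hpow.contDiffAt.of_le (natCast_le_infty _)),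
      iteratedDeriv_fun_pow_zero]
    split_ifs with hij
    · rw [smul_smul, mul_inv_cancel₀ (by exact_mod_cast j.factorial_ne_zero), one_smul]
    · simp
  have hg : (fun u => f u - p u) =O[𝓝 0] fun u : ℝ => u ^ (j + 1) := by
    refine isBigO_pow_of_iteratedDeriv_eq_zero (hf.sub hpC.contDiffAt) fun i hi => ?_
    rw [iteratedDeriv_fun_sub (hf.of_le (natCast_le_infty _))
      (hpC.contDiffAt.of_le (natCast_le_infty _)), hpd]
    split_ifs with hij
    · rw [hij, ← hc, sub_self]
    · rw [ih i (by omega) (by omega), sub_zero]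
  have hle : (fun u : ℝ => u ^ m) =O[𝓝 0] fun u : ℝ => u ^ (j + 1) := by
    refine IsBigO.of_bound 1 ?_
    filter_upwards [Metric.closedBall_mem_nhds (0 : ℝ) one_pos] with u hu
    rw [norm_pow, norm_pow, one_mul]
    exact pow_le_pow_of_le_one (norm_nonneg _) (by simpa using hu) hj
  have hpO : p =O[𝓝 0] fun u : ℝ => u ^ (j + 1) := by
    simpa using (h.trans hle).sub hg
  have hlt : (fun u : ℝ => u ^ (j + 1)) =o[𝓝 0] fun u : ℝ => u ^ j := by
    exact isLittleO_pow_pow (by omega)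
  have hpo := hpO.trans_isLittleO hlt
  have hc0 : (fun _ : ℝ => (j.factorial : ℝ)⁻¹ • c) =o[𝓝[≠] 0] fun _ : ℝ => (1 : ℝ) := by
    have := (isBigO_refl (fun u : ℝ => (u ^ j)⁻¹) (𝓝[≠] 0)).smul_isLittleO
      (hpo.mono nhdsWithin_le_nhds)
    refine this.congr' ?_ ?_ <;>
    · filter_upwards [self_mem_nhdsWithin] with u hu
      have : u ^ j ≠ 0 := pow_ne_zero _ hu
      simp [hp, smul_smul, this]
  rw [isLittleO_one_iff] at hc0
  have := tendsto_nhds_unique hc0 tendsto_const_nhds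
  simpa [j.factorial_ne_zero] using this.symm

/-- An `O`-bound cannot be differentiated in general; for smooth `f` it is equivalent to vanishing
Taylor coefficients, which shift under differentiation. -/
theorem deriv_isBigO_pow {f : ℝ → W} {m : ℕ} (hf : ContDiffAt ℝ ∞ f 0)
    (h : f =O[𝓝 0] fun u : ℝ => u ^ (m + 1)) : deriv f =O[𝓝 0] fun u : ℝ => u ^ m := by
  refine isBigO_pow_of_iteratedDeriv_eq_zero ?_ ?_
  · exact ContDiffAt.derivWithin hf (by simp)
  · intro j hj
    rw [← iteratedDeriv_succ']
    exact iteratedDeriv_eq_zero_of_isBigO_pow hf h _ (by omega)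

theorem iteratedDeriv_eq_of_isBigO_pow {f g : ℝ → W} (hf : ContDiffAt ℝ ∞ f 0)
    (hg : ContDiffAt ℝ ∞ g 0) (h : ∀ m : ℕ, (fun u => f u - g u) =O[𝓝 0] fun u : ℝ => u ^ m)
    (k : ℕ) : iteratedDeriv k f 0 = iteratedDeriv k g 0 := by
  have := iteratedDeriv_eq_zero_of_isBigO_pow (hf.sub hg) (h (k + 1)) k (by omega)
  rwa [iteratedDeriv_fun_sub (hf.of_le (natCast_le_infty _))
      (hg.of_le (natCast_le_infty _)), sub_eq_zero] at this

/-- Bounds `O(u ^ m)` that hold at all parameters are inherited by parameter derivatives. -/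
theorem fderiv_param_isBigO_pow {U : Set E} {J : Set ℝ} (hU : IsOpen U) (hJ : IsOpen J)
    (h0 : (0 : ℝ) ∈ J) {m : ℕ} {F : E × ℝ → W} (hF : ContDiffOn ℝ ∞ F (U ×ˢ J))
    (h : ∀ y ∈ U, (fun u => F (y, u)) =O[𝓝 0] fun u : ℝ => u ^ m) :
    ∀ y ∈ U, (fun u => fderiv ℝ (fun x => F (x, u)) y) =O[𝓝 0] fun u : ℝ => u ^ m := by
  have hUJ := hU.prod hJ
  induction m generalizing F with
  | zero =>
    intro y hy
    have hd : ContDiffAt ℝ ∞ (fun u => fderiv ℝ (fun x => F (x, u)) y) 0 := by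
      refine ContDiffAt.fderiv (m := ∞) (n := ∞) (f := fun u x => F (x, u)) ?_
        contDiffAt_const (by simp)
      exact (hF.contDiffAt (hUJ.mem_nhds ⟨hy, h0⟩)).comp ((0 : ℝ), y)
        (contDiffAt_snd.prodMk contDiffAt_fst)
    simpa using hd.continuousAt.isBigO_one ℝ
  | succ m ih =>
    intro y hy
    -- `H = ∂_u F` loses one order in `u`, so the induction hypothesis bounds `∂_y H`. By symmetry
    -- of second derivatives this is `∂_u ∂_y F`, and integrating in `u` recovers the lost order.
    set H : E × ℝ → W := fun z => fderiv ℝ F z (0, 1) with hHdef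
    have hFd : ContDiffOn ℝ ∞ (fderiv ℝ F) (U ×ˢ J) :=
      hF.fderiv_of_isOpen hUJ (by simp)
    have hH : ContDiffOn ℝ ∞ H (U ×ˢ J) := hFd.clm_apply contDiffOn_const
    have hFat (x : E) (hx : x ∈ U) (u : ℝ) (hu : u ∈ J) : HasFDerivAt F (fderiv ℝ F (x, u)) (x, u) :=
      ((hF.contDiffAt (hUJ.mem_nhds ⟨hx, hu⟩)).differentiableAt (by simp)).hasFDerivAt
    have hFdat (x : E) (hx : x ∈ U) (u : ℝ) (hu : u ∈ J) :
        HasFDerivAt (fderiv ℝ F) (fderiv ℝ (fderiv ℝ F) (x, u)) (x, u) :=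
      ((hFd.contDiffAt (hUJ.mem_nhds ⟨hx, hu⟩)).differentiableAt (by simp)).hasFDerivAt
    have hu1 (x : E) (u : ℝ) : HasDerivAt (fun u : ℝ => (x, u)) ((0 : E), (1 : ℝ)) u :=
      (hasDerivAt_const u x).prodMk (hasDerivAt_id u)
    have hHO (x : E) (hx : x ∈ U) : (fun u => H (x, u)) =O[𝓝 0] fun u : ℝ => u ^ m := by
      have hc : ContDiffAt ℝ ∞ (fun u => F (x, u)) 0 :=
        (hF.contDiffAt (hUJ.mem_nhds ⟨hx, h0⟩)).comp (0 : ℝ)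
          (contDiffAt_const.prodMk contDiffAt_id)
      refine (deriv_isBigO_pow hc (h x hx)).congr' ?_ EventuallyEq.rfl
      filter_upwards [hJ.mem_nhds h0] with u hu
      exact ((hFat x hx u hu).comp_hasDerivAt u (hu1 x u)).deriv
    have hx1 (x : E) (u : ℝ) : HasFDerivAt (fun x : E => (x, u)) (.inl ℝ E ℝ) x :=
      (hasFDerivAt_id x).prodMk (hasFDerivAt_const u x)
    have hslice (x : E) (hx : x ∈ U) (u : ℝ) (hu : u ∈ J) :
        fderiv ℝ (fun x => F (x, u)) x = (fderiv ℝ F (x, u)).comp (.inl ℝ E ℝ) :=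
      ((hFat x hx u hu).comp x (hx1 x u)).fderiv
    have hsym (u : ℝ) (hu : u ∈ J) : HasDerivAt (fun u => fderiv ℝ (fun x => F (x, u)) y)
        (fderiv ℝ (fun x => H (x, u)) y) u := by
      have e1 : (fun u => (fderiv ℝ F (y, u)).comp (.inl ℝ E ℝ)) =ᶠ[𝓝 u]
          fun u => fderiv ℝ (fun x => F (x, u)) y := by
        filter_upwards [hJ.mem_nhds hu] with s hs
        exact (hslice y hy s hs).symm
      refine HasDerivAt.congr_of_eventuallyEq ?_ e1.symm
      have e2 : fderiv ℝ (fun x => H (x, u)) y =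
          (fderiv ℝ (fderiv ℝ F) (y, u) (0, 1)).comp (.inl ℝ E ℝ) := by
        have h1 := ((hFdat y hy u hu).clm_apply
          (hasFDerivAt_const ((0 : E), (1 : ℝ)) (y, u))).comp y (hx1 y u)
        change fderiv ℝ ((fun z => fderiv ℝ F z (0, 1)) ∘ fun x => (x, u)) y = _
        rw [h1.fderiv]
        ext x
        have := (hF.contDiffAt (hUJ.mem_nhds (show (y, u) ∈ U ×ˢ J from ⟨hy, hu⟩))).isSymmSndFDerivAt
          (by rw [minSmoothness_of_isRCLikeNormedField]
              exact natCast_le_infty 2)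
        simpa using this.eq (x, 0) (0, 1)
      rw [e2]
      have h2 := (hFdat y hy u hu).comp_hasDerivAt u (hu1 y u)
      exact ((ContinuousLinearMap.compL ℝ E (E × ℝ) W).flip
        (.inl ℝ E ℝ)).hasFDerivAt.comp_hasDerivAt u h2
    refine isBigO_pow_succ_of_deriv ?_ ?_ ?_
    · filter_upwards [hJ.mem_nhds h0] with u hu using (hsym u hu).differentiableAt
    · have : (fun x => F (x, 0)) =ᶠ[𝓝 y] fun _ => 0 := by
        filter_upwards [hU.mem_nhds hy] with x hx
        have := (h x hx).eq_zero_imp.self_of_nhds (by simp)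
        exact this
      rw [this.fderiv_eq]; simp
    · refine (ih hH hHO y hy).congr' ?_ EventuallyEq.rfl
      filter_upwards [hJ.mem_nhds h0] with u hu
      exact (hsym u hu).deriv.symm

/-- `C¹` maps are locally Lipschitz, so pointwise nonlinear operations lose no order of agreement.
-/
theorem ContDiffAt.isBigO_comp_sub {Φ : W → W'} {a : W} (hΦ : ContDiffAt ℝ 1 Φ a)
    {ι : Type*} {l : Filter ι} {f g : ι → W} (hf : Tendsto f l (𝓝 a)) (hg : Tendsto g l (𝓝 a)) :
    (fun i => Φ (f i) - Φ (g i)) =O[l] fun i => f i - g i := by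
  obtain ⟨K, t, ht, hK⟩ := hΦ.exists_lipschitzOnWith
  refine IsBigO.of_bound K ?_
  filter_upwards [hf ht, hg ht] with i hi hi'
  exact hK.norm_sub_le hi hi'

end Jets
end WeightedAmbient

namespace WeightedAmbient

open Filter Asymptotics Topology

/-! ### Christoffel symbols of `2 du dv + g_u` -/

section Coordinates

set_option maxSynthPendingDepth 3

variable {V : Type*} [NormedAddCommGroup V] [NormedSpace ℝ V]

/-- The Christoffel symbols as a function of the metric and of its derivative. -/
noncomputable def christoffelOf (b : Bil V) (D : V →L[ℝ] V →L[ℝ] V →L[ℝ] ℝ) : V →L[ℝ] V →L[ℝ] V :=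
  (2⁻¹ : ℝ) • ((ContinuousLinearMap.compL ℝ V (V →L[ℝ] ℝ) V b.inverse).comp D +
    (ContinuousLinearMap.compL ℝ V (V →L[ℝ] ℝ) V b.inverse).comp D.flip -
    (ContinuousLinearMap.compL ℝ V (V →L[ℝ] ℝ) V b.inverse).comp
      (((ContinuousLinearMap.flipₗᵢ ℝ V V ℝ).toContinuousLinearEquiv :
        (V →L[ℝ] V →L[ℝ] ℝ) →L[ℝ] (V →L[ℝ] V →L[ℝ] ℝ)).comp D.flip))

theorem christoffel_eq_christoffelOf (G : V → Bil V) (x : V) :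
    christoffel G x = christoffelOf (G x) (fderiv ℝ G x) := rfl

/-- Treating the metric and its derivative as independent variables makes this a smooth map near
invertible `b`, because inversion is smooth. It serves both for smoothness and for comparing jets.
-/
theorem contDiffAt_christoffelOf [CompleteSpace V] {b : Bil V} (hb : b.IsInvertible)
    (D : V →L[ℝ] V →L[ℝ] V →L[ℝ] ℝ) {m : ℕ∞ω} :
    ContDiffAt ℝ m (fun p : Bil V × (V →L[ℝ] V →L[ℝ] V →L[ℝ] ℝ) => christoffelOf p.1 p.2)
      (b, D) := by
  have h1 : ContDiffAt ℝ m (fun p : Bil V × (V →L[ℝ] V →L[ℝ] V →L[ℝ] ℝ) =>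
      ContinuousLinearMap.compL ℝ V (V →L[ℝ] ℝ) V p.1.inverse) (b, D) :=
    (ContinuousLinearMap.contDiff _).contDiffAt.comp (b, D)
      (hb.contDiffAt_map_inverse.comp (b, D) contDiffAt_fst)
  have h2 : ContDiffAt ℝ m (fun p : Bil V × (V →L[ℝ] V →L[ℝ] V →L[ℝ] ℝ) => p.2.flip) (b, D) :=
    (ContinuousLinearMap.flipₗᵢ ℝ V V (V →L[ℝ] ℝ)).contDiff.contDiffAt.comp (b, D) contDiffAt_snd
  exact (((h1.clm_comp contDiffAt_snd).add (h1.clm_comp h2)).sub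
    (h1.clm_comp (contDiffAt_const.clm_comp h2))).const_smul _

theorem christoffel_contDiffAt [CompleteSpace V] {G : V → Bil V} {x : V} (hG : ContDiffAt ℝ ∞ G x)
    (hb : (G x).IsInvertible) : ContDiffAt ℝ ∞ (christoffel G) x :=
  ContDiffAt.comp (g := fun p : Bil V × (V →L[ℝ] V →L[ℝ] V →L[ℝ] ℝ) => christoffelOf p.1 p.2)
    (f := fun x => (G x, fderiv ℝ G x)) x (contDiffAt_christoffelOf hb (fderiv ℝ G x))
    (hG.prodMk (hG.fderiv_right (by simp)))

theorem christoffel_symm {G : V → Bil V} {x : V} (hd : DifferentiableAt ℝ G x)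
    (hG : ∀ᶠ y in 𝓝 x, ∀ X Y, G y X Y = G y Y X) (X Y : V) :
    christoffel G x X Y = christoffel G x Y X := by
  have hs (Z : V) : fderiv ℝ G x Z X Y = fderiv ℝ G x Z Y X := by
    have h1 (A B : V) : fderiv ℝ G x Z A B = fderiv ℝ (fun y => G y A B) x Z := by
      have := ((hd.hasFDerivAt.clm_apply (hasFDerivAt_const A x)).clm_apply
        (hasFDerivAt_const B x)).fderiv
      rw [this]; simp
    rw [h1, h1]
    have : (fun y => G y X Y) =ᶠ[𝓝 x] fun y => G y Y X := hG.mono fun y h => h X Y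
    rw [this.fderiv_eq]
  set θ : V →L[ℝ] ℝ := fderiv ℝ G x X Y + fderiv ℝ G x Y X - ((fderiv ℝ G x).flip X).flip Y with hθ
  rw [christoffel_apply G x X Y θ (fun Z => by simp [hθ]),
    christoffel_apply G x Y X θ (fun Z => by simp [hθ, hs]; ring)]

theorem fderiv_clm_apply₂ {W : Type*} [NormedAddCommGroup W] [NormedSpace ℝ W]
    {A B : Type*} [NormedAddCommGroup A] [NormedSpace ℝ A] [NormedAddCommGroup B] [NormedSpace ℝ B]
    {Γ : W → A →L[ℝ] A →L[ℝ] B} {z : W} (h : DifferentiableAt ℝ Γ z) (X : W) (Y Z : A) :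
    fderiv ℝ Γ z X Y Z = fderiv ℝ (fun w => Γ w Y Z) z X := by
  have := ((h.hasFDerivAt.clm_apply (hasFDerivAt_const Y z)).clm_apply
    (hasFDerivAt_const Z z)).fderiv
  rw [this]
  simp

theorem metricTrace_smul [FiniteDimensional ℝ V] {b : Bil V} (hb : b.IsInvertible) (κ : ℝ)
    {T : V →ₗ[ℝ] V →ₗ[ℝ] ℝ} (hT : ∀ X Y, T X Y = κ * b X Y) :
    metricTrace b T = Module.finrank ℝ V * κ := by
  have : (b.inverse : (V →L[ℝ] ℝ) →ₗ[ℝ] V) ∘ₗ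
      (LinearMap.toContinuousLinearMap : (V →ₗ[ℝ] ℝ) ≃ₗ[ℝ] (V →L[ℝ] ℝ)).toLinearMap ∘ₗ T
      = κ • LinearMap.id := by
    ext X
    have h : LinearMap.toContinuousLinearMap (T X) = κ • b X := by
      ext Y; simp [hT]
    simp [h, hb.inverse_apply_self]
  rw [metricTrace, this, map_smul, LinearMap.trace_id, smul_eq_mul, mul_comm]

/-- The ambient metric `2 du dv + G` in coordinates `(v, y, u)`. -/
noncomputable def warped (G : V × ℝ → Bil V) (z : ℝ × V × ℝ) : Bil (ℝ × V × ℝ) :=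
  let dv : (ℝ × V × ℝ) →L[ℝ] ℝ := ContinuousLinearMap.fst ℝ ℝ (V × ℝ)
  let dy : (ℝ × V × ℝ) →L[ℝ] V :=
    (ContinuousLinearMap.fst ℝ V ℝ).comp (ContinuousLinearMap.snd ℝ ℝ (V × ℝ))
  let du : (ℝ × V × ℝ) →L[ℝ] ℝ :=
    (ContinuousLinearMap.snd ℝ V ℝ).comp (ContinuousLinearMap.snd ℝ ℝ (V × ℝ))
  dv.smulRight du + du.smulRight dv + (G z.2).bilinearComp dy dy

theorem warped_apply (G : V × ℝ → Bil V) (z ξ η : ℝ × V × ℝ) :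
    warped G z ξ η = ξ.1 * η.2.2 + ξ.2.2 * η.1 + G z.2 ξ.2.1 η.2.1 := by
  simp [warped]

/-- The inclusion of the tangent space of the middle factor. -/
noncomputable def inMid (V : Type*) [NormedAddCommGroup V] [NormedSpace ℝ V] : V →L[ℝ] ℝ × V × ℝ :=
  (ContinuousLinearMap.inr ℝ ℝ (V × ℝ)).comp (ContinuousLinearMap.inl ℝ V ℝ)

@[simp] theorem inMid_apply (x : V) : inMid V x = (0, x, 0) := rfl

variable (V) in
/-- Pullback of bilinear forms along the projection to the middle factor. -/
noncomputable def pullMid : Bil V →L[ℝ] Bil (ℝ × V × ℝ) :=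
  (((ContinuousLinearMap.compL ℝ (ℝ × V × ℝ) V ℝ).flip
    ((ContinuousLinearMap.fst ℝ V ℝ).comp (ContinuousLinearMap.snd ℝ ℝ (V × ℝ)))).postcomp
      (ℝ × V × ℝ)).comp (ContinuousLinearMap.precomp (V →L[ℝ] ℝ)
        ((ContinuousLinearMap.fst ℝ V ℝ).comp (ContinuousLinearMap.snd ℝ ℝ (V × ℝ))))

@[simp] theorem pullMid_apply (b : Bil V) (ξ η : ℝ × V × ℝ) :
    pullMid V b ξ η = b ξ.2.1 η.2.1 := rfl

/-- A constant form plus a continuous linear image of `G`: smoothness and derivatives of the ambient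
metric are then those of `G`. -/
theorem warped_eq_add (G : V × ℝ → Bil V) : warped G = fun z => warped 0 0 + pullMid V (G z.2) := by
  ext1 z
  refine ContinuousLinearMap.ext fun ξ => ContinuousLinearMap.ext fun η => ?_
  simp [warped_apply]

theorem warped_contDiffAt {G : V × ℝ → Bil V} {z : ℝ × V × ℝ} (hG : ContDiffAt ℝ ∞ G z.2) :
    ContDiffAt ℝ ∞ (warped G) z := by
  rw [warped_eq_add]
  exact contDiffAt_const.add
    ((pullMid V).contDiff.contDiffAt.comp z (hG.comp z contDiffAt_snd))

theorem warped_isInvertible_and_inverse {G : V × ℝ → Bil V} {z : ℝ × V × ℝ}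
    (hb : (G z.2).IsInvertible) : (warped G z).IsInvertible ∧ ∀ θ, (warped G z).inverse θ =
      (θ (0, 0, 1), (G z.2).inverse (θ.comp (inMid V)), θ (1, 0, 0)) := by
  let ev (w : ℝ × V × ℝ) : ((ℝ × V × ℝ) →L[ℝ] ℝ) →L[ℝ] ℝ := ContinuousLinearMap.apply ℝ ℝ w
  -- The block `2 du dv` is off-diagonal, so raising an index exchanges the `v` and `u` components.
  let S : ((ℝ × V × ℝ) →L[ℝ] ℝ) →L[ℝ] (ℝ × V × ℝ) := (ev (0, 0, 1)).prod
    (((G z.2).inverse.comp ((inMid V).precomp ℝ)).prod (ev (1, 0, 0)))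
  have hS (θ) : S θ = (θ (0, 0, 1), (G z.2).inverse (θ.comp (inMid V)), θ (1, 0, 0)) := rfl
  have h1 : (warped G z).comp S = .id ℝ _ := by
    refine ContinuousLinearMap.ext fun θ => ContinuousLinearMap.ext fun η => ?_
    have hη : η = η.1 • (1, 0, 0) + inMid V η.2.1 + η.2.2 • (0, 0, 1) := by
      ext <;> simp
    conv_rhs => rw [hη]
    simp only [ContinuousLinearMap.comp_apply, hS, warped_apply, hb.self_apply_inverse,
      ContinuousLinearMap.id_apply, map_add, map_smul, smul_eq_mul]
    ring
  have h2 : S.comp (warped G z) = .id ℝ _ := by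
    refine ContinuousLinearMap.ext fun ξ => ?_
    have : ((warped G z) ξ).comp (inMid V) = G z.2 ξ.2.1 := by
      ext x; simp [warped_apply]
    rw [ContinuousLinearMap.comp_apply, hS, this, hb.inverse_apply_self]
    ext <;> simp [warped_apply]
  refine ⟨.of_inverse h1 h2, fun θ => ?_⟩
  rw [ContinuousLinearMap.inverse_eq h1 h2, hS]

theorem fderiv_slice {W : Type*} [NormedAddCommGroup W] [NormedSpace ℝ W] {F : V × ℝ → W}
    {y : V} {u : ℝ} (hF : DifferentiableAt ℝ F (y, u)) :
    fderiv ℝ (fun x => F (x, u)) y = (fderiv ℝ F (y, u)).comp (.inl ℝ V ℝ) :=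
  (hF.hasFDerivAt.comp y ((hasFDerivAt_id y).prodMk (hasFDerivAt_const u y))).fderiv

/-- Only the middle block varies, and it does not depend on `v`. Since raising an index swaps `v`
and `u`, the term `-½ ∂_u G` lands in the `v` slot, while the `u` slot receives a `∂_v`-derivative,
which is zero. -/
theorem christoffel_warped {G : V × ℝ → Bil V} {z : ℝ × V × ℝ} (hG : DifferentiableAt ℝ G z.2)
    (hb : (G z.2).IsInvertible) (ξ η : ℝ × V × ℝ) :
    christoffel (warped G) z ξ η = (-(2⁻¹ * fderiv ℝ G z.2 (0, 1) ξ.2.1 η.2.1),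
      christoffel (fun y => G (y, z.2.2)) z.2.1 ξ.2.1 η.2.1 +
        (2⁻¹ : ℝ) • (G z.2).inverse (ξ.2.2 • fderiv ℝ G z.2 (0, 1) η.2.1 +
          η.2.2 • fderiv ℝ G z.2 (0, 1) ξ.2.1), 0) := by
  set D := fderiv ℝ G z.2 with hD
  have hW (ζ a c : ℝ × V × ℝ) : fderiv ℝ (warped G) z ζ a c = D ζ.2 a.2.1 c.2.1 := by
    have h := ((pullMid V).hasFDerivAt.comp z (hG.hasFDerivAt.comp z hasFDerivAt_snd)).const_add
      (warped 0 0)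
    have h' : fderiv ℝ (warped G) z =
        (pullMid V).comp ((fderiv ℝ G z.2).comp (ContinuousLinearMap.snd ℝ ℝ (V × ℝ))) := by
      rw [warped_eq_add]; exact h.fderiv
    rw [h']
    simp [hD]
  have hsl := fderiv_slice (y := z.2.1) (u := z.2.2) hG
  have hinv := warped_isInvertible_and_inverse hb
  set θ : (ℝ × V × ℝ) →L[ℝ] ℝ := fderiv ℝ (warped G) z ξ η + fderiv ℝ (warped G) z η ξ -
    ((fderiv ℝ (warped G) z).flip ξ).flip η with hθ
  rw [christoffel_apply (warped G) z ξ η θ (fun Z => by simp [hθ]), hinv.2]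
  set τ : V →L[ℝ] ℝ := D (ξ.2.1, 0) η.2.1 + D (η.2.1, 0) ξ.2.1 -
    ((D.comp (.inl ℝ V ℝ)).flip ξ.2.1).flip η.2.1 with hτ
  rw [christoffel_apply (fun y => G (y, z.2.2)) z.2.1 ξ.2.1 η.2.1 τ
    (fun Z => by rw [hsl]; simp [hτ, hD])]
  have hsplit (a : V × ℝ) : D a = D (a.1, 0) + a.2 • D (0, 1) := by
    rw [← map_smul, ← map_add]; simp
  ext
  · simp [hθ, hW]
  · have : θ.comp (inMid V) = τ + (ξ.2.2 • D (0, 1) η.2.1 + η.2.2 • D (0, 1) ξ.2.1) := by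
      ext x
      simp only [hθ, hτ, ContinuousLinearMap.comp_apply, sub_apply,
        add_apply, ContinuousLinearMap.flip_apply, hW, inMid_apply,
        smul_apply, ContinuousLinearMap.inl_apply]
      rw [hsplit ξ.2, hsplit η.2]
      simp only [add_apply, smul_apply]
      ring
    simp [this]
  · have h0 : D ((0 : V), (0 : ℝ)) = 0 := map_zero D
    simp [hθ, hW, h0]

end Coordinates
end WeightedAmbient

namespace WeightedAmbient

open Filter Asymptotics Topology

/-! ### Ricci tensor, Hessian and scalar equation of the ambient space -/

section AmbientCurvature

set_option maxSynthPendingDepth 3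

variable {V : Type*} [NormedAddCommGroup V] [NormedSpace ℝ V]

theorem ricci_apply (G : V → Bil V) (x Y Z : V) :
    ricci G x Y Z = LinearMap.trace ℝ V (curvatureEnd G x Y Z : V →ₗ[ℝ] V) := rfl

theorem curvatureEnd_apply (G : V → Bil V) (x X Y Z : V) :
    curvatureEnd G x Y Z X = fderiv ℝ (christoffel G) x X Y Z - fderiv ℝ (christoffel G) x Y X Z +
      christoffel G x X (christoffel G x Y Z) - christoffel G x Y (christoffel G x X Z) := rfl

theorem hessian_apply (G : V → Bil V) (f : V → ℝ) (x X Y : V) :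
    hessian G f x X Y = fderiv ℝ (fderiv ℝ f) x X Y - fderiv ℝ f x (christoffel G x X Y) := rfl

/-- `T` kills `∂_v` and its image has no `∂_u` component, so both outer diagonal entries vanish. -/
theorem trace_eq_trace_mid [FiniteDimensional ℝ V] (T : (ℝ × V × ℝ) →ₗ[ℝ] ℝ × V × ℝ)
    (S : V →ₗ[ℝ] V) (h1 : T (1, 0, 0) = 0) (h2 : ∀ ξ, (T ξ).2.2 = 0)
    (hS : ∀ x, (T (0, x, 0)).2.1 = S x) : LinearMap.trace ℝ _ T = LinearMap.trace ℝ V S := by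
  let ι : V →ₗ[ℝ] ℝ × V × ℝ := LinearMap.inr ℝ ℝ (V × ℝ) ∘ₗ LinearMap.inl ℝ V ℝ
  let π : (ℝ × V × ℝ) →ₗ[ℝ] V := LinearMap.fst ℝ V ℝ ∘ₗ LinearMap.snd ℝ ℝ (V × ℝ)
  let υ : (ℝ × V × ℝ) →ₗ[ℝ] ℝ := LinearMap.snd ℝ V ℝ ∘ₗ LinearMap.snd ℝ ℝ (V × ℝ)
  have hT : T = (T ∘ₗ ι) ∘ₗ π + υ.smulRight (T (0, 0, 1)) := by
    refine LinearMap.ext fun ξ => ?_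
    have hξ : ξ = ξ.1 • (1, 0, 0) + ι ξ.2.1 + ξ.2.2 • (0, 0, 1) := by
      ext <;> simp [ι]
    conv_lhs => rw [hξ]
    rw [map_add, map_add, map_smul, map_smul, h1]
    simp [π, υ]
  have hS' : S = π ∘ₗ (T ∘ₗ ι) := by
    ext x; simp [← hS, π, ι]
  rw [hT, map_add, LinearMap.trace_smulRight, LinearMap.trace_comp_comm', hS']
  simp [υ, h2]

variable {S : Set (V × ℝ)} {G : V × ℝ → Bil V} {z : ℝ × V × ℝ} {f : V × ℝ → ℝ}

theorem slice_eventually_mem (hS : IsOpen S) {y : V} {u : ℝ} (hq : (y, u) ∈ S) :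
    ∀ᶠ x in 𝓝 y, (x, u) ∈ S :=
  (hS.preimage (continuous_id.prodMk continuous_const)).mem_nhds hq

theorem slice_differentiableAt {W : Type*} [NormedAddCommGroup W] [NormedSpace ℝ W]
    {F : V × ℝ → W} {y : V} {u : ℝ} (hF : DifferentiableAt ℝ F (y, u)) :
    DifferentiableAt ℝ (fun x => F (x, u)) y :=
  hF.comp y (differentiableAt_id.prodMk (differentiableAt_const u))

theorem fderiv_sub_fst (hf : DifferentiableAt ℝ f z.2) (ξ : ℝ × V × ℝ) :
    fderiv ℝ (fun w : ℝ × V × ℝ => f w.2 - w.1) z ξ = fderiv ℝ f z.2 ξ.2 - ξ.1 := by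
  have := ((hf.hasFDerivAt.comp z hasFDerivAt_snd).sub hasFDerivAt_fst).fderiv
  change fderiv ℝ ((f ∘ Prod.snd) - Prod.fst) z ξ = _
  rw [this]
  rfl

theorem fderiv_fderiv_sub_fst (hS : IsOpen S) (hf : ContDiffOn ℝ ∞ f S) (hz : z.2 ∈ S)
    (ξ η : ℝ × V × ℝ) :
    fderiv ℝ (fderiv ℝ fun w : ℝ × V × ℝ => f w.2 - w.1) z ξ η =
      fderiv ℝ (fderiv ℝ f) z.2 ξ.2 η.2 := by
  have e : (fderiv ℝ fun w : ℝ × V × ℝ => f w.2 - w.1) =ᶠ[𝓝 z] fun w =>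
      (ContinuousLinearMap.precomp ℝ (ContinuousLinearMap.snd ℝ ℝ (V × ℝ))) (fderiv ℝ f w.2) -
        ContinuousLinearMap.fst ℝ ℝ (V × ℝ) := by
    filter_upwards [(hS.preimage continuous_snd).mem_nhds hz] with w hw
    refine ContinuousLinearMap.ext fun ξ => ?_
    rw [fderiv_sub_fst ((hf.contDiffAt (hS.mem_nhds hw)).differentiableAt (by simp))]
    rfl
  have hd : DifferentiableAt ℝ (fderiv ℝ f) z.2 :=
    ((hf.contDiffAt (hS.mem_nhds hz)).fderiv_right (m := ∞) (by simp)).differentiableAt (by simp)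
  have := (((ContinuousLinearMap.precomp ℝ (ContinuousLinearMap.snd ℝ ℝ (V × ℝ))).hasFDerivAt.comp
    z (hd.hasFDerivAt.comp z hasFDerivAt_snd)).sub_const
      (ContinuousLinearMap.fst ℝ ℝ (V × ℝ))).fderiv
  rw [e.fderiv_eq]
  change fderiv ℝ (fun w => ((ContinuousLinearMap.precomp ℝ (ContinuousLinearMap.snd ℝ ℝ (V × ℝ))) ∘
    fderiv ℝ f ∘ Prod.snd) w - ContinuousLinearMap.fst ℝ ℝ (V × ℝ)) z ξ η = _
  rw [this]
  rfl

theorem fderiv_fderiv_slice (hS : IsOpen S) (hf : ContDiffOn ℝ ∞ f S) {y : V} {u : ℝ}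
    (hq : (y, u) ∈ S) (X Y : V) :
    fderiv ℝ (fderiv ℝ fun y => f (y, u)) y X Y =
      fderiv ℝ (fderiv ℝ f) (y, u) (X, 0) (Y, 0) := by
  have e : (fderiv ℝ fun y => f (y, u)) =ᶠ[𝓝 y] fun y =>
      ContinuousLinearMap.precomp ℝ (.inl ℝ V ℝ) (fderiv ℝ f (y, u)) := by
    filter_upwards [slice_eventually_mem hS hq] with x hx
    exact fderiv_slice ((hf.contDiffAt (hS.mem_nhds hx)).differentiableAt (by simp))
  have hd : DifferentiableAt ℝ (fderiv ℝ f) (y, u) :=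
    ((hf.contDiffAt (hS.mem_nhds hq)).fderiv_right (m := ∞) (by simp)).differentiableAt (by simp)
  have := ((ContinuousLinearMap.precomp ℝ (.inl ℝ V ℝ)).hasFDerivAt.comp y (hd.hasFDerivAt.comp
    (f := fun y => (y, u)) y ((hasFDerivAt_id y).prodMk (hasFDerivAt_const u y)))).fderiv
  rw [e.fderiv_eq]
  change fderiv ℝ ((ContinuousLinearMap.precomp ℝ (.inl ℝ V ℝ)) ∘ fderiv ℝ f ∘ fun y => (y, u))
    y X Y = _
  rw [this]
  rfl

variable [CompleteSpace V]

theorem christoffel_warped_differentiableAt {G : V × ℝ → Bil V} {z : ℝ × V × ℝ}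
    (hG : ContDiffAt ℝ ∞ G z.2) (hb : (G z.2).IsInvertible) :
    DifferentiableAt ℝ (christoffel (warped G)) z :=
  (christoffel_contDiffAt (warped_contDiffAt hG)
    (warped_isInvertible_and_inverse hb).1).differentiableAt (by simp)

/-- For differentiating one component, picked out by `p`, of the ambient symbols from a closed
formula `k` free of `v`. -/
theorem fderiv_christoffel_warped (hS : IsOpen S) (hG : ContDiffOn ℝ ∞ G S)
    (hb : ∀ q ∈ S, (G q).IsInvertible) (hz : z.2 ∈ S) (X Y Z : ℝ × V × ℝ)
    {B : Type*} [NormedAddCommGroup B] [NormedSpace ℝ B] (p : (ℝ × V × ℝ) →L[ℝ] B) (k : V × ℝ → B)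
    (hk : ∀ v, ∀ q ∈ S, p (christoffel (warped G) (v, q) Y Z) = k q) :
    DifferentiableAt ℝ k z.2 ∧
    p (fderiv ℝ (christoffel (warped G)) z X Y Z) = fderiv ℝ k z.2 X.2 := by
  have hd := christoffel_warped_differentiableAt (hG.contDiffAt (hS.mem_nhds hz)) (hb _ hz)
  have hd1 : DifferentiableAt ℝ (fun w => p (christoffel (warped G) w Y Z)) z :=
    p.differentiableAt.comp z
      ((hd.clm_apply (differentiableAt_const Y)).clm_apply (differentiableAt_const Z))
  have e1 : (fun w => p (christoffel (warped G) w Y Z)) =ᶠ[𝓝 z] k ∘ Prod.snd := by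
    filter_upwards [(hS.preimage continuous_snd).mem_nhds hz] with w hw
    exact hk w.1 w.2 hw
  have e2 : (fun q => p (christoffel (warped G) (z.1, q) Y Z)) =ᶠ[𝓝 z.2] k := by
    filter_upwards [hS.mem_nhds hz] with q hq
    exact hk z.1 q hq
  have hkd : DifferentiableAt ℝ k z.2 :=
    (DifferentiableAt.comp (g := fun w => p (christoffel (warped G) w Y Z)) z.2 hd1
      ((differentiableAt_const z.1).prodMk differentiableAt_id)).congr_of_eventuallyEq e2.symm
  refine ⟨hkd, ?_⟩
  rw [fderiv_clm_apply₂ hd]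
  have h3 : p (fderiv ℝ (fun w => christoffel (warped G) w Y Z) z X) =
      fderiv ℝ (fun w => p (christoffel (warped G) w Y Z)) z X := by
    have := (p.hasFDerivAt.comp z ((hd.clm_apply (differentiableAt_const Y)).clm_apply
      (differentiableAt_const Z)).hasFDerivAt).fderiv
    change _ = fderiv ℝ (p ∘ fun w => christoffel (warped G) w Y Z) z X
    rw [this]; rfl
  rw [h3, e1.fderiv_eq, (hkd.hasFDerivAt.comp z hasFDerivAt_snd).fderiv]
  rfl

theorem contDiffOn_slice_christoffel (hS : IsOpen S) (hG : ContDiffOn ℝ ∞ G S)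
    (hb : ∀ q ∈ S, (G q).IsInvertible) :
    ContDiffOn ℝ ∞ (fun q : V × ℝ => christoffel (fun y => G (y, q.2)) q.1) S := by
  intro q hq
  have hGq := hG.contDiffAt (hS.mem_nhds hq)
  have h1 : ContDiffAt ℝ ∞ (fun q : V × ℝ => fderiv ℝ (fun y => G (y, q.2)) q.1) q := by
    have h2 : ContDiffAt ℝ ∞ (fun q => (fderiv ℝ G q).comp (.inl ℝ V ℝ)) q :=
      (hGq.fderiv_right (by simp)).clm_comp contDiffAt_const
    refine h2.congr_of_eventuallyEq ?_
    filter_upwards [hS.mem_nhds hq] with r hr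
    exact fderiv_slice (y := r.1) (u := r.2)
      ((hG.contDiffAt (hS.mem_nhds hr)).differentiableAt (by simp))
  exact (ContDiffAt.comp
    (g := fun p : Bil V × (V →L[ℝ] V →L[ℝ] V →L[ℝ] ℝ) => christoffelOf p.1 p.2)
    (f := fun q : V × ℝ => (G q, fderiv ℝ (fun y => G (y, q.2)) q.1)) q
    (contDiffAt_christoffelOf (hb q hq) _) (hGq.prodMk h1)).contDiffWithinAt

variable [FiniteDimensional ℝ V]

/-- The ambient Ricci tensor is the trace of the middle block of the ambient curvature. -/
theorem ricci_warped_eq_trace (hS : IsOpen S) (hG : ContDiffOn ℝ ∞ G S)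
    (hb : ∀ q ∈ S, (G q).IsInvertible) (hz : z.2 ∈ S) (Y Z : ℝ × V × ℝ) (T : V →ₗ[ℝ] V)
    (hT : ∀ x, (curvatureEnd (warped G) z Y Z (0, x, 0)).2.1 = T x) :
    ricci (warped G) z Y Z = LinearMap.trace ℝ V T := by
  have hΓ (w : ℝ × V × ℝ) (hw : w.2 ∈ S) := christoffel_warped
    ((hG.contDiffAt (hS.mem_nhds hw)).differentiableAt (by simp)) (hb _ hw)
  -- The field `∂_v` is parallel, which removes the `∂_v` column of the curvature endomorphism.
  have hΓv (w : ℝ × V × ℝ) (hw : w.2 ∈ S) (η : ℝ × V × ℝ) :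
      christoffel (warped G) w (1, 0, 0) η = 0 := by
    rw [hΓ w hw]; ext <;> simp
  have hdu (X Y Z : ℝ × V × ℝ) : (fderiv ℝ (christoffel (warped G)) z X Y Z).2.2 = 0 := by
    have := (fderiv_christoffel_warped hS hG hb hz X Y Z
      ((ContinuousLinearMap.snd ℝ V ℝ).comp (ContinuousLinearMap.snd ℝ ℝ (V × ℝ))) (fun _ => 0)
      (fun v q hq => by rw [hΓ (v, q) hq]; rfl)).2
    simpa using this
  rw [ricci_apply]
  refine trace_eq_trace_mid _ T ?_ ?_ hT
  · have h1 : fderiv ℝ (christoffel (warped G)) z (1, 0, 0) Y Z = 0 := by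
      have := (fderiv_christoffel_warped hS hG hb hz (1, 0, 0) Y Z (.id ℝ _)
        (fun q => christoffel (warped G) (0, q) Y Z)
        (fun v q hq => by rw [hΓ (0, q) hq]; exact hΓ (v, q) hq _ _)).2
      exact this.trans (map_zero _)
    have h2 : fderiv ℝ (christoffel (warped G)) z Y (1, 0, 0) Z = 0 := by
      have := (fderiv_christoffel_warped hS hG hb hz Y (1, 0, 0) Z (.id ℝ _)
        (fun q => 0) (fun v q hq => hΓv (v, q) hq _)).2
      simpa using this
    change curvatureEnd (warped G) z Y Z (1, 0, 0) = 0
    rw [curvatureEnd_apply, h1, h2, hΓv z hz, hΓv z hz, map_zero]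
    simp
  · intro X
    change (curvatureEnd (warped G) z Y Z X).2.2 = 0
    rw [curvatureEnd_apply]
    simp [hdu, hΓ z hz]

/-- The term `-½ ∂_u G` enters `Γ(Y, Z)` only along the parallel field `∂_v`, so it never feeds back
into the middle block of the curvature. -/
theorem ricci_warped_mid (hS : IsOpen S) (hG : ContDiffOn ℝ ∞ G S)
    (hb : ∀ q ∈ S, (G q).IsInvertible) (hz : z.2 ∈ S) (Y Z : V) :
    ricci (warped G) z (0, Y, 0) (0, Z, 0) = ricci (fun y => G (y, z.2.2)) z.2.1 Y Z := by
  rw [ricci_apply (fun y => G (y, z.2.2))]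
  refine ricci_warped_eq_trace hS hG hb hz _ _ _ fun x => ?_
  obtain ⟨v₀, y, u⟩ := z
  have hΓ (w : ℝ × V × ℝ) (hw : w.2 ∈ S) := christoffel_warped
    ((hG.contDiffAt (hS.mem_nhds hw)).differentiableAt (by simp)) (hb _ hw)
  have hd (X Y Z : V) : (fderiv ℝ (christoffel (warped G)) (v₀, y, u) (0, X, 0) (0, Y, 0) (0, Z, 0)).2.1 =
      fderiv ℝ (christoffel fun y => G (y, u)) y X Y Z := by
    have h1 := fderiv_christoffel_warped hS hG hb hz (0, X, 0) (0, Y, 0) (0, Z, 0)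
      ((ContinuousLinearMap.fst ℝ V ℝ).comp (ContinuousLinearMap.snd ℝ ℝ (V × ℝ)))
      (fun q => christoffel (fun y => G (y, q.2)) q.1 Y Z)
      (fun v q hq => by rw [hΓ (v, q) hq]; simp)
    have h2 := fderiv_slice (y := y) (u := u) h1.1
    refine h1.2.trans ?_
    rw [fderiv_clm_apply₂]
    · exact (DFunLike.congr_fun h2 X).symm
    · have h3 := ((contDiffOn_slice_christoffel hS hG hb).contDiffAt
        (hS.mem_nhds hz)).differentiableAt (by simp)
      exact slice_differentiableAt (F := fun q : V × ℝ => christoffel (fun y => G (y, q.2)) q.1)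
        (y := y) (u := u) h3
  rw [curvatureEnd_apply]
  change _ = curvatureEnd (fun y => G (y, u)) y Y Z x
  rw [curvatureEnd_apply]
  simp only [Prod.snd_sub, Prod.snd_add, Prod.fst_sub, Prod.fst_add, hd, hΓ _ hz]
  simp

/-- The last term comes from the summand `-v` of the potential, paired with the `v` component of
`Γ(ξ, η)`. -/
theorem hessian_warped (hS : IsOpen S) (hG : ContDiffOn ℝ ∞ G S) (hb : ∀ q ∈ S, (G q).IsInvertible)
    (hf : ContDiffOn ℝ ∞ f S) (hz : z.2 ∈ S) (ξ η : ℝ × V × ℝ) :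
    hessian (warped G) (fun w => f w.2 - w.1) z ξ η = fderiv ℝ (fderiv ℝ f) z.2 ξ.2 η.2 -
      fderiv ℝ f z.2 ((christoffel (warped G) z ξ η).2.1, 0) -
        2⁻¹ * fderiv ℝ G z.2 (0, 1) ξ.2.1 η.2.1 := by
  rw [hessian_apply, fderiv_fderiv_sub_fst hS hf hz,
    fderiv_sub_fst ((hf.contDiffAt (hS.mem_nhds hz)).differentiableAt (by simp)),
    christoffel_warped ((hG.contDiffAt (hS.mem_nhds hz)).differentiableAt (by simp)) (hb _ hz)]
  ring

theorem hessian_warped_mid (hS : IsOpen S) (hG : ContDiffOn ℝ ∞ G S)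
    (hb : ∀ q ∈ S, (G q).IsInvertible) (hf : ContDiffOn ℝ ∞ f S) (hz : z.2 ∈ S) (X Y : V) :
    hessian (warped G) (fun w => f w.2 - w.1) z (0, X, 0) (0, Y, 0) =
      hessian (fun y => G (y, z.2.2)) (fun y => f (y, z.2.2)) z.2.1 X Y -
        2⁻¹ * fderiv ℝ G z.2 (0, 1) X Y := by
  rw [hessian_warped hS hG hb hf hz, hessian_apply, fderiv_fderiv_slice hS hf hz,
    fderiv_slice (y := z.2.1) (u := z.2.2)
      ((hf.contDiffAt (hS.mem_nhds hz)).differentiableAt (by simp)),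
    christoffel_warped ((hG.contDiffAt (hS.mem_nhds hz)).differentiableAt (by simp)) (hb _ hz)]
  simp

/-- Setting this to zero gives the evolution equation `∂_u g = 2 (Ric + ∇²φ)`. -/
theorem weightedRicci_warped_mid (hS : IsOpen S) (hG : ContDiffOn ℝ ∞ G S)
    (hb : ∀ q ∈ S, (G q).IsInvertible) (hf : ContDiffOn ℝ ∞ f S) (hz : z.2 ∈ S) (X Y : V) :
    weightedRicci (warped G) (fun w => f w.2 - w.1) z (0, X, 0) (0, Y, 0) =
      weightedRicci (fun y => G (y, z.2.2)) (fun y => f (y, z.2.2)) z.2.1 X Y -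
        2⁻¹ * fderiv ℝ G z.2 (0, 1) X Y := by
  simp only [weightedRicci, LinearMap.add_apply]
  rw [ricci_warped_mid hS hG hb hz, hessian_warped_mid hS hG hb hf hz]
  ring

/-- The differential of `f - v` has components `-1` along `v` and `∂_u f` along `u`, so the cross
term of the square norm is `-2 ∂_u f`. Setting the whole to zero determines `∂_u f` once `∂_u G` is
known. -/
theorem weightedF_warped (hS : IsOpen S) (hG : ContDiffOn ℝ ∞ G S)
    (hb : ∀ q ∈ S, (G q).IsInvertible) (hf : ContDiffOn ℝ ∞ f S) (hz : z.2 ∈ S)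
    (T : V →ₗ[ℝ] V →ₗ[ℝ] ℝ)
    (hT : ∀ X Y, T X Y = hessian (fun y => G (y, z.2.2)) (fun y => f (y, z.2.2)) z.2.1 X Y -
        2⁻¹ * fderiv ℝ G z.2 (0, 1) X Y) :
    weightedF (warped G) (fun w => f w.2 - w.1) z = metricTrace (G z.2) T -
      gradSq (fun y => G (y, z.2.2)) (fun y => f (y, z.2.2)) z.2.1 +
        2 * fderiv ℝ f z.2 (0, 1) := by
  have hinv := (warped_isInvertible_and_inverse (hb _ hz)).2
  have hfd : DifferentiableAt ℝ f z.2 :=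
    (hf.contDiffAt (hS.mem_nhds hz)).differentiableAt (by simp)
  have hΓ := christoffel_warped
    ((hG.contDiffAt (hS.mem_nhds hz)).differentiableAt (by simp)) (hb _ hz)
  have h1 : laplacian (warped G) (fun w => f w.2 - w.1) z = metricTrace (G z.2) T := by
    refine trace_eq_trace_mid _ _ ?_ ?_ ?_
    · have : hessian (warped G) (fun w => f w.2 - w.1) z (1, 0, 0) = 0 := by
        refine LinearMap.ext fun η => ?_
        rw [hessian_warped hS hG hb hf hz, hΓ]
        have h0 : ((0 : V), (0 : ℝ)) = 0 := rfl
        simp [h0]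
      simp [this]
    · intro ξ
      have : hessian (warped G) (fun w => f w.2 - w.1) z ξ (1, 0, 0) = 0 := by
        rw [hessian_warped hS hG hb hf hz, hΓ]
        have h0 : ((0 : V), (0 : ℝ)) = 0 := rfl
        simp [h0]
      simp [hinv, this]
    · intro x
      simp only [LinearMap.comp_apply, LinearEquiv.coe_coe, ContinuousLinearMap.coe_coe, hinv]
      congr 1
      ext Y
      simp [hT, hessian_warped_mid hS hG hb hf hz]
  have h2 : gradSq (warped G) (fun w => f w.2 - w.1) z =
      gradSq (fun y => G (y, z.2.2)) (fun y => f (y, z.2.2)) z.2.1 - 2 * fderiv ℝ f z.2 (0, 1) := by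
    simp only [gradSq]
    rw [hinv, fderiv_slice (y := z.2.1) (u := z.2.2) hfd, fderiv_sub_fst hfd, fderiv_sub_fst hfd,
      fderiv_sub_fst hfd]
    have e : (fderiv ℝ (fun w : ℝ × V × ℝ => f w.2 - w.1) z).comp (inMid V) =
        (fderiv ℝ f z.2).comp (.inl ℝ V ℝ) := by
      ext x
      simp [fderiv_sub_fst hfd]
    rw [e]
    have hsplit (a : V) : fderiv ℝ f z.2 (a, -1) = fderiv ℝ f z.2 (a, 0) - fderiv ℝ f z.2 (0, 1) := by
      rw [← map_sub]; simp
    have h0 : fderiv ℝ f z.2 ((0 : V), (0 : ℝ)) = 0 := map_zero _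
    simp [h0, hsplit]
    ring
  rw [weightedF, h1, h2]
  ring

end AmbientCurvature
end WeightedAmbient

namespace WeightedAmbient

open Filter Asymptotics Topology

/-! ### The explicit ambient metric over an Einstein metric -/

section ScaledMetric

set_option maxSynthPendingDepth 3

variable {V : Type*} [NormedAddCommGroup V] [NormedSpace ℝ V]

theorem christoffel_congr {G G' : V → Bil V} {x : V} (h : G =ᶠ[𝓝 x] G') :
    christoffel G x = christoffel G' x := by
  rw [christoffel_eq_christoffelOf, christoffel_eq_christoffelOf, h.fderiv_eq, h.eq_of_nhds]

theorem inverse_smul_apply {b : Bil V} (hb : b.IsInvertible) {a : ℝ} (ha : a ≠ 0)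
    (θ : V →L[ℝ] ℝ) : (a • b).inverse θ = a⁻¹ • b.inverse θ := by
  have h1 : (a • b).comp (a⁻¹ • b.inverse) = .id ℝ _ := by
    ext1 θ
    simp [smul_smul, ha, hb.self_apply_inverse]
  have h2 : (a⁻¹ • b.inverse).comp (a • b) = .id ℝ _ := by
    ext1 x
    simp [smul_smul, ha, hb.inverse_apply_self]
  rw [ContinuousLinearMap.inverse_eq h1 h2]
  rfl

theorem isInvertible_smul {b : Bil V} (hb : b.IsInvertible) {a : ℝ} (ha : a ≠ 0) :
    (a • b).IsInvertible := by
  obtain ⟨e, rfl⟩ := hb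
  exact ⟨e.trans (ContinuousLinearEquiv.smulLeft (Units.mk0 a ha)), by ext; simp⟩

/-- The factor `a` from the derivative cancels `a⁻¹` from raising the index: homothetic metrics
share their connection, hence their Ricci tensor. -/
theorem christoffel_smul {G : V → Bil V} {x : V} (hb : (G x).IsInvertible) {a : ℝ} (ha : a ≠ 0) :
    christoffel (fun y => a • G y) x = christoffel G x := by
  have hf : fderiv ℝ (fun y => a • G y) x = a • fderiv ℝ G x := by
    exact congrFun (fderiv_const_smul_field (𝕜 := ℝ) (f := G) a) x
  ext X Y
  set θ : V →L[ℝ] ℝ := fderiv ℝ G x X Y + fderiv ℝ G x Y X - ((fderiv ℝ G x).flip X).flip Y with hθ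
  rw [christoffel_apply G x X Y θ (fun Z => by simp [hθ]),
    christoffel_apply (fun y => a • G y) x X Y (a • θ) (fun Z => by simp [hθ, hf]; ring),
    inverse_smul_apply hb ha]
  simp [smul_smul, ha]

theorem ricci_smul {G : V → Bil V} {x : V} (hb : ∀ᶠ y in 𝓝 x, (G y).IsInvertible) {a : ℝ}
    (ha : a ≠ 0) : ricci (fun y => a • G y) x = ricci G x := by
  have h1 : christoffel (fun y => a • G y) =ᶠ[𝓝 x] christoffel G :=
    hb.mono fun y hy => christoffel_smul hy ha
  ext Y Z
  rw [ricci_apply, ricci_apply, curvatureEnd, curvatureEnd, h1.fderiv_eq, h1.eq_of_nhds]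

variable [CompleteSpace V] [FiniteDimensional ℝ V]

/-- The explicit solution of the ambient equations over an Einstein metric. -/
theorem ambient_equations_of_einstein {U : Set V} (hU : IsOpen U) {J : Set ℝ} (hJ : IsOpen J)
    {κ c : ℝ} (hκ : ∀ u ∈ J, 0 < 1 + κ * u) {G₀ : V → Bil V} (hG₀ : ContDiffOn ℝ ∞ G₀ U)
    (hb : ∀ y ∈ U, (G₀ y).IsInvertible) (hs : ∀ y ∈ U, ∀ X Y, G₀ y X Y = G₀ y Y X)
    (hE : ∀ y ∈ U, ∀ X Y, ricci G₀ y X Y = κ / 2 * G₀ y X Y) {G : V × ℝ → Bil V} {f : V × ℝ → ℝ}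
    (hG : ∀ q ∈ U ×ˢ J, G q = (1 + κ * q.2) • G₀ q.1)
    (hf : ∀ q ∈ U ×ˢ J, f q = Module.finrank ℝ V / 4 * Real.log (1 + κ * q.2) + c)
    {v : ℝ} {y : V} {u : ℝ} (hy : y ∈ U) (hu : u ∈ J) :
    (∀ ξ η, weightedRicci (warped G) (fun w => f w.2 - w.1) (v, y, u) ξ η = 0) ∧
      weightedF (warped G) (fun w => f w.2 - w.1) (v, y, u) = 0 := by
  set N : ℝ := (Module.finrank ℝ V : ℝ) with hN
  set S := U ×ˢ J with hSdef
  have hS : IsOpen S := hU.prod hJ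
  have hGS : ContDiffOn ℝ ∞ G S := by
    refine ContDiffOn.congr ?_ hG
    have h1 : ContDiffOn ℝ ∞ (fun q : V × ℝ => 1 + κ * q.2) S := by fun_prop
    exact h1.smul (hG₀.comp contDiffOn_fst fun q (hq : q ∈ S) => hq.1)
  have hfS : ContDiffOn ℝ ∞ f S := by
    refine ContDiffOn.congr ?_ hf
    refine (contDiffOn_const.mul (ContDiffOn.log (by fun_prop) fun q hq => ?_)).add contDiffOn_const
    exact (hκ _ hq.2).ne'
  have hbS : ∀ q ∈ S, (G q).IsInvertible := fun q hq => by
    rw [hG q hq]; exact isInvertible_smul (hb _ hq.1) (hκ _ hq.2).ne'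
  have hGu (q : V × ℝ) (hq : q ∈ S) : fderiv ℝ G q (0, 1) = κ • G₀ q.1 := by
    have e : G =ᶠ[𝓝 q] fun q => (1 + κ * q.2) • G₀ q.1 := by
      filter_upwards [hS.mem_nhds hq] with r hr using hG r hr
    have h0 : HasFDerivAt G₀ (fderiv ℝ G₀ q.1) q.1 :=
      ((hG₀.contDiffAt (hU.mem_nhds hq.1)).differentiableAt (by simp)).hasFDerivAt
    have := (((hasFDerivAt_snd (𝕜 := ℝ) (p := q)).const_mul κ).const_add 1).smul
      (h0.comp q hasFDerivAt_fst)
    rw [e.fderiv_eq]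
    change fderiv ℝ ((fun q : V × ℝ => 1 + κ * q.2) • (G₀ ∘ Prod.fst)) q (0, 1) = _
    rw [this.fderiv]
    simp
  have hslice (q : V × ℝ) (hq : q ∈ S) :
      (fun x => G (x, q.2)) =ᶠ[𝓝 q.1] fun x => (1 + κ * q.2) • G₀ x := by
    filter_upwards [hU.mem_nhds hq.1] with x hx using hG (x, q.2) ⟨hx, hq.2⟩
  have hΓs (q : V × ℝ) (hq : q ∈ S) :
      christoffel (fun x => G (x, q.2)) q.1 = christoffel G₀ q.1 := by
    rw [christoffel_congr (hslice q hq), christoffel_smul (hb _ hq.1) (hκ _ hq.2).ne']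
  have hΓ (w : ℝ × V × ℝ) (hw : w.2 ∈ S) (ξ η : ℝ × V × ℝ) :
      christoffel (warped G) w ξ η = (-(2⁻¹ * (κ * G₀ w.2.1 ξ.2.1 η.2.1)),
        christoffel G₀ w.2.1 ξ.2.1 η.2.1 + (κ / (2 * (1 + κ * w.2.2))) •
          (ξ.2.2 • η.2.1 + η.2.2 • ξ.2.1), 0) := by
    rw [christoffel_warped ((hGS.contDiffAt (hS.mem_nhds hw)).differentiableAt (by simp))
      (hbS _ hw), hGu _ hw, hΓs _ hw, hG _ hw, inverse_smul_apply (hb _ hw.1) (hκ _ hw.2).ne']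
    simp only [smul_apply, smul_eq_mul, map_add, map_smul,
      (hb _ hw.1).inverse_apply_self, smul_smul, smul_add]
    have := (hκ _ hw.2).ne'
    congr 4 <;> congr 1 <;> field_simp
  have hq : (y, u) ∈ S := ⟨hy, hu⟩
  have ha := (hκ u hu).ne'
  have hΓ0 : DifferentiableAt ℝ (christoffel G₀) y :=
    (christoffel_contDiffAt (hG₀.contDiffAt (hU.mem_nhds hy)) (hb y hy)).differentiableAt (by simp)
  have hinv : ∀ (g : ℝ → ℝ) (g' : ℝ), HasDerivAt g g' u →
      HasFDerivAt (fun q : V × ℝ => g q.2) (g' • ContinuousLinearMap.snd ℝ V ℝ) (y, u) :=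
    fun g g' hg => hg.comp_hasFDerivAt (y, u) hasFDerivAt_snd
  have hs' : HasDerivAt (fun u => κ / (2 * (1 + κ * u))) (-κ ^ 2 / (2 * (1 + κ * u) ^ 2)) u := by
    have h1 : HasDerivAt (fun u => 2 * (1 + κ * u)) (2 * κ) u := by
      simpa using (((hasDerivAt_id u).const_mul κ).const_add 1).const_mul 2
    have := (hasDerivAt_const u κ).div h1 (by positivity)
    refine this.congr_deriv ?_
    field_simp
    ring
  have hdΓ (X Y Z : ℝ × V × ℝ) : (fderiv ℝ (christoffel (warped G)) (v, y, u) X Y Z).2.1 =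
      fderiv ℝ (christoffel G₀) y X.2.1 Y.2.1 Z.2.1 +
        (X.2.2 * (-κ ^ 2 / (2 * (1 + κ * u) ^ 2))) • (Y.2.2 • Z.2.1 + Z.2.2 • Y.2.1) := by
    have h1 := (fderiv_christoffel_warped hS hGS hbS (z := (v, y, u)) hq X Y Z
      ((ContinuousLinearMap.fst ℝ V ℝ).comp (ContinuousLinearMap.snd ℝ ℝ (V × ℝ)))
      (fun q => christoffel G₀ q.1 Y.2.1 Z.2.1 + (κ / (2 * (1 + κ * q.2))) •
          (Y.2.2 • Z.2.1 + Z.2.2 • Y.2.1))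
      (fun v q hq => by rw [hΓ (v, q) hq]; rfl)).2
    refine h1.trans ?_
    have h2 : HasFDerivAt (fun q : V × ℝ => christoffel G₀ q.1 Y.2.1 Z.2.1)
        ((fderiv ℝ (fun x => christoffel G₀ x Y.2.1 Z.2.1) y).comp
          (ContinuousLinearMap.fst ℝ V ℝ)) (y, u) := by
      refine HasFDerivAt.comp (g := fun x => christoffel G₀ x Y.2.1 Z.2.1) (y, u) ?_ hasFDerivAt_fst
      exact ((hΓ0.clm_apply (differentiableAt_const _)).clm_apply
        (differentiableAt_const _)).hasFDerivAt
    have h3 := (hinv _ _ hs').smul_const (Y.2.2 • Z.2.1 + Z.2.2 • Y.2.1)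
    have := (h2.add h3).fderiv
    refine (DFunLike.congr_fun this X.2).trans ?_
    rw [fderiv_clm_apply₂ hΓ0]
    simp [mul_comm]
  have hsymm (X Y : V) : christoffel G₀ y X Y = christoffel G₀ y Y X :=
    christoffel_symm ((hG₀.contDiffAt (hU.mem_nhds hy)).differentiableAt (by simp))
      (by filter_upwards [hU.mem_nhds hy] with x hx using hs x hx) X Y
  -- With `a = κ / (2(1 + κu))`, the `du²` coefficient is `-N (a' + a²) = N κ² / (4(1 + κu)²)`. It
  -- will cancel `f'' = -N κ² / (4(1 + κu)²)`, while `κ/2 * G₀` cancels `-½ ∂_u G`.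
  have hric (Y Z : ℝ × V × ℝ) : ricci (warped G) (v, y, u) Y Z = κ / 2 * G₀ y Y.2.1 Z.2.1 +
      N * (κ ^ 2 / (4 * (1 + κ * u) ^ 2)) * (Y.2.2 * Z.2.2) := by
    rw [ricci_warped_eq_trace hS hGS hbS (z := (v, y, u)) hq Y Z
      ((curvatureEnd G₀ y Y.2.1 Z.2.1 : V →ₗ[ℝ] V) +
        (κ ^ 2 / (4 * (1 + κ * u) ^ 2) * (Y.2.2 * Z.2.2)) • LinearMap.id) ?_, map_add, map_smul,
      ← ricci_apply, hE y hy, LinearMap.trace_id]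
    · simp only [smul_eq_mul]; ring
    · intro x
      rw [curvatureEnd_apply]
      simp only [Prod.snd_sub, Prod.snd_add, Prod.fst_sub, Prod.fst_add, hdΓ, hΓ (v, y, u) hq]
      rw [LinearMap.add_apply, ContinuousLinearMap.coe_coe, curvatureEnd_apply]
      simp only [map_add, map_smul, LinearMap.smul_apply, LinearMap.id_apply]
      rw [hsymm x Y.2.1]
      match_scalars <;> field_simp <;> ring
  have hlin (s : ℝ) : HasDerivAt (fun u => 1 + κ * u) κ s := by
    simpa using ((hasDerivAt_id s).const_mul κ).const_add 1
  have hFd (s : ℝ) (hs : s ∈ J) :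
      HasDerivAt (fun u => N / 4 * Real.log (1 + κ * u) + c) (N / 4 * (κ / (1 + κ * s))) s :=
    (((hlin s).log (hκ s hs).ne').const_mul _).add_const _
  have hfd (q : V × ℝ) (hq : q ∈ S) :
      fderiv ℝ f q = (N / 4 * (κ / (1 + κ * q.2))) • ContinuousLinearMap.snd ℝ V ℝ := by
    have e : f =ᶠ[𝓝 q] fun q => N / 4 * Real.log (1 + κ * q.2) + c := by
      filter_upwards [hS.mem_nhds hq] with r hr using hf r hr
    rw [e.fderiv_eq]
    exact ((hFd q.2 hq.2).comp_hasFDerivAt q hasFDerivAt_snd).fderiv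
  have hfdd : fderiv ℝ (fderiv ℝ f) (y, u) = ((N / 4 * (-κ ^ 2 / (1 + κ * u) ^ 2)) •
      ContinuousLinearMap.snd ℝ V ℝ).smulRight (ContinuousLinearMap.snd ℝ V ℝ) := by
    have e : fderiv ℝ f =ᶠ[𝓝 (y, u)] fun q =>
        (N / 4 * (κ / (1 + κ * q.2))) • ContinuousLinearMap.snd ℝ V ℝ := by
      filter_upwards [hS.mem_nhds hq] with r hr using hfd r hr
    have h1 : HasDerivAt (fun u => N / 4 * (κ / (1 + κ * u)))
        (N / 4 * (-κ ^ 2 / (1 + κ * u) ^ 2)) u := by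
      refine (((hasDerivAt_const u κ).div (hlin u) ha).const_mul (N / 4)).congr_deriv ?_
      ring
    rw [e.fderiv_eq]
    exact ((hinv _ _ h1).smul_const _).fderiv
  constructor
  · intro ξ η
    rw [weightedRicci, LinearMap.add_apply, LinearMap.add_apply, hric,
      hessian_warped hS hGS hbS hfS (z := (v, y, u)) hq, hfdd, hfd _ hq, hGu _ hq]
    simp only [ContinuousLinearMap.smulRight_apply, smul_apply, ContinuousLinearMap.coe_snd',
      smul_eq_mul]
    field_simp
    ring
  · have hinvG := hb y hy
    have hG' : (G (y, u)).inverse 0 = 0 := map_zero _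
    have hsl : (fun x => f (x, u)) =ᶠ[𝓝 y] fun _ => N / 4 * Real.log (1 + κ * u) + c := by
      filter_upwards [hU.mem_nhds hy] with x hx using hf (x, u) ⟨hx, hu⟩
    -- As `f` is constant on slices, only `-½ κ G₀` is left, rewritten as a multiple of `G`. Its
    -- trace `-N κ / (2(1 + κu))` is cancelled by `2 ∂_u f`.
    let T : V →ₗ[ℝ] V →ₗ[ℝ] ℝ :=
      LinearMap.mk₂ ℝ (fun X Y => (-(κ / (2 * (1 + κ * u)))) * G (y, u) X Y)
        (by intros; simp; ring) (by intros; simp; ring) (by intros; simp; ring)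
        (by intros; simp; ring)
    rw [weightedF_warped hS hGS hbS hfS (z := (v, y, u)) hq T ?_,
      metricTrace_smul (hbS _ hq) (-(κ / (2 * (1 + κ * u)))) (fun X Y => rfl), gradSq,
      hsl.fderiv_eq, hfd _ hq]
    · simp
      field_simp
      ring
    · intro X Y
      have h2 : (fderiv ℝ fun x => f (x, u)) =ᶠ[𝓝 y] fun _ => 0 :=
        hsl.eventuallyEq_nhds.mono fun x hx => by rw [hx.fderiv_eq]; simp
      rw [hessian_apply]
      simp only [h2.fderiv_eq, h2.eq_of_nhds, hGu _ hq]
      change -(κ / (2 * (1 + κ * u))) * G (y, u) X Y = _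
      rw [hG _ hq]
      simp
      field_simp

end ScaledMetric
end WeightedAmbient

namespace WeightedAmbient

open Filter Asymptotics Topology

/-! ### Formal uniqueness of ambient solutions -/

section JetUniqueness

set_option maxSynthPendingDepth 3

/-- `f` and `g` have the same limit `a` at `0` and agree there to order `u ^ m`. -/
def JetEq {W : Type*} [NormedAddCommGroup W] (m : ℕ) (a : W) (f g : ℝ → W) : Prop :=
  Tendsto f (𝓝 0) (𝓝 a) ∧ Tendsto g (𝓝 0) (𝓝 a) ∧
    (fun u => f u - g u) =O[𝓝 0] fun u : ℝ => u ^ m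

section

variable {W W' : Type*} [NormedAddCommGroup W] [NormedAddCommGroup W']

/-- The condition `1 ≤ m` makes the difference tend to zero, so the second function acquires the
limit of the first. -/
theorem JetEq.of_isBigO {m : ℕ} (hm : 1 ≤ m) {f g : ℝ → W} (hf : ContinuousAt f 0)
    (h : (fun u => f u - g u) =O[𝓝 0] fun u : ℝ => u ^ m) : JetEq m (f 0) f g := by
  refine ⟨hf, ?_, h⟩
  have h0 : Tendsto (fun u : ℝ => u ^ m) (𝓝 0) (𝓝 0) := by
    have : ContinuousAt (fun u : ℝ => u ^ m) 0 := by fun_prop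
    simpa [ContinuousAt, zero_pow (by omega : m ≠ 0)] using this
  have := hf.tendsto.sub (h.trans_tendsto h0)
  simpa using this

theorem JetEq.prodMk {m : ℕ} {a : W} {b : W'} {f g : ℝ → W} {f' g' : ℝ → W'} (h : JetEq m a f g)
    (h' : JetEq m b f' g') : JetEq m (a, b) (fun u => (f u, f' u)) fun u => (g u, g' u) :=
  ⟨h.1.prodMk_nhds h'.1, h.2.1.prodMk_nhds h'.2.1, h.2.2.prod_left h'.2.2⟩

variable [NormedSpace ℝ W] [NormedSpace ℝ W']

theorem JetEq.comp {m : ℕ} {a : W} {f g : ℝ → W} (h : JetEq m a f g) {Φ : W → W'}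
    (hΦ : ContDiffAt ℝ 1 Φ a) : JetEq m (Φ a) (fun u => Φ (f u)) fun u => Φ (g u) :=
  ⟨hΦ.continuousAt.tendsto.comp h.1, hΦ.continuousAt.tendsto.comp h.2.1,
    (ContDiffAt.isBigO_comp_sub hΦ h.1 h.2.1).trans h.2.2⟩

end

variable {V : Type*} [NormedAddCommGroup V] [NormedSpace ℝ V]

theorem contDiffOn_slice_fderiv {W : Type*} [NormedAddCommGroup W] [NormedSpace ℝ W]
    {S : Set (V × ℝ)} (hS : IsOpen S) {F : V × ℝ → W} (hF : ContDiffOn ℝ ∞ F S) :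
    ContDiffOn ℝ ∞ (fun q : V × ℝ => fderiv ℝ (fun y => F (y, q.2)) q.1) S := by
  have h2 : ContDiffOn ℝ ∞ (fun q => (fderiv ℝ F q).comp (.inl ℝ V ℝ)) S :=
    (hF.fderiv_of_isOpen hS (by simp)).clm_comp contDiffOn_const
  exact h2.congr fun r hr => fderiv_slice (y := r.1) (u := r.2)
    ((hF.contDiffAt (hS.mem_nhds hr)).differentiableAt (by simp))

variable {U : Set V} {J : Set ℝ}

/-- Spatial derivatives cost no order because the agreement is assumed at every point of the open
set `U`, not just at `y`. -/
theorem JetEq.fderiv_slice {W : Type*} [NormedAddCommGroup W] [NormedSpace ℝ W] {m : ℕ}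
    (hm : 1 ≤ m) (hU : IsOpen U) (hJ : IsOpen J) (h0 : (0 : ℝ) ∈ J)
    {F F' : V × ℝ → W} (hF : ContDiffOn ℝ ∞ F (U ×ˢ J)) (hF' : ContDiffOn ℝ ∞ F' (U ×ˢ J))
    (h : ∀ y ∈ U, JetEq m (F (y, 0)) (fun u => F (y, u)) fun u => F' (y, u)) :
    ∀ y ∈ U, JetEq m (fderiv ℝ (fun x => F (x, 0)) y) (fun u => fderiv ℝ (fun x => F (x, u)) y)
      fun u => fderiv ℝ (fun x => F' (x, u)) y := by
  intro y hy
  have hUJ := hU.prod hJ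
  have hmem : (y, (0 : ℝ)) ∈ U ×ˢ J := ⟨hy, h0⟩
  refine JetEq.of_isBigO (f := fun u => fderiv ℝ (fun x => F (x, u)) y) hm ?_ ?_
  · exact ContinuousAt.comp (g := fun q : V × ℝ => fderiv ℝ (fun y => F (y, q.2)) q.1)
      (f := fun u : ℝ => (y, u)) (x := (0 : ℝ))
      ((contDiffOn_slice_fderiv hUJ hF).contDiffAt (hUJ.mem_nhds hmem)).continuousAt (by fun_prop)
  · refine (fderiv_param_isBigO_pow hU hJ h0 (hF.sub hF') (fun x hx => (h x hx).2.2) y hy).congr'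
      ?_ EventuallyEq.rfl
    filter_upwards [hJ.mem_nhds h0] with u hu
    have hat {F : V × ℝ → W} (hF : ContDiffOn ℝ ∞ F (U ×ˢ J)) :
        DifferentiableAt ℝ (fun x => F (x, u)) y :=
      slice_differentiableAt ((hF.contDiffAt (hUJ.mem_nhds
        (show (y, u) ∈ U ×ˢ J from ⟨hy, hu⟩))).differentiableAt (by simp))
    exact fderiv_sub (hat hF) (hat hF')

section Slices

variable {W : Type*} [NormedAddCommGroup W] [NormedSpace ℝ W] {F F' : V × ℝ → W} {y : V}

theorem contDiffOn_slice_snd (hF : ContDiffOn ℝ ∞ F (U ×ˢ J))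
    (hy : y ∈ U) : ContDiffOn ℝ ∞ (fun u => F (y, u)) J :=
  hF.comp (contDiffOn_const.prodMk contDiffOn_id) fun _ hu => ⟨hy, hu⟩

theorem hasDerivAt_slice_snd (hU : IsOpen U) (hJ : IsOpen J) (hF : ContDiffOn ℝ ∞ F (U ×ˢ J))
    (hy : y ∈ U) {u : ℝ} (hu : u ∈ J) : HasDerivAt (fun u => F (y, u)) (fderiv ℝ F (y, u) (0, 1)) u :=
  ((hF.contDiffAt ((hU.prod hJ).mem_nhds (show (y, u) ∈ U ×ˢ J from ⟨hy, hu⟩))).differentiableAt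
    (by simp)).hasFDerivAt.comp_hasDerivAt u ((hasDerivAt_const u y).prodMk (hasDerivAt_id u))

theorem continuousAt_slice_snd (hJ : IsOpen J) (h0 : (0 : ℝ) ∈ J)
    (hF : ContDiffOn ℝ ∞ F (U ×ˢ J)) (hy : y ∈ U) : ContinuousAt (fun u => F (y, u)) 0 :=
  ((contDiffOn_slice_snd hF hy).contDiffAt (hJ.mem_nhds h0)).continuousAt

theorem contDiffOn_fderiv_snd (hU : IsOpen U) (hJ : IsOpen J) (hF : ContDiffOn ℝ ∞ F (U ×ˢ J)) :
    ContDiffOn ℝ ∞ (fun q => fderiv ℝ F q (0, 1)) (U ×ˢ J) :=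
  (hF.fderiv_of_isOpen (hU.prod hJ) (by simp)).clm_apply contDiffOn_const

theorem isBigO_slice_succ (hU : IsOpen U) (hJ : IsOpen J) (h0 : (0 : ℝ) ∈ J)
    (hF : ContDiffOn ℝ ∞ F (U ×ˢ J)) (hF' : ContDiffOn ℝ ∞ F' (U ×ˢ J)) (hy : y ∈ U)
    (he : F (y, 0) = F' (y, 0)) {m : ℕ}
    (h : (fun u => fderiv ℝ F (y, u) (0, 1) - fderiv ℝ F' (y, u) (0, 1)) =O[𝓝 0]
      fun u : ℝ => u ^ m) :
    (fun u => F (y, u) - F' (y, u)) =O[𝓝 0] fun u : ℝ => u ^ (m + 1) := by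
  refine isBigO_pow_succ_of_deriv ?_ (by simp [he]) (h.congr' ?_ EventuallyEq.rfl)
  · filter_upwards [hJ.mem_nhds h0] with u hu
    exact ((hasDerivAt_slice_snd hU hJ hF hy hu).sub
      (hasDerivAt_slice_snd hU hJ hF' hy hu)).differentiableAt
  · filter_upwards [hJ.mem_nhds h0] with u hu
    exact (((hasDerivAt_slice_snd hU hJ hF hy hu).sub
      (hasDerivAt_slice_snd hU hJ hF' hy hu)).deriv).symm

theorem JetEq.one_of_eq (hU : IsOpen U) (hJ : IsOpen J) (h0 : (0 : ℝ) ∈ J)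
    (hF : ContDiffOn ℝ ∞ F (U ×ˢ J)) (hF' : ContDiffOn ℝ ∞ F' (U ×ˢ J)) (hy : y ∈ U)
    (he : F (y, 0) = F' (y, 0)) :
    JetEq (0 + 1) (F (y, 0)) (fun u => F (y, u)) (fun u => F' (y, u)) := by
  refine JetEq.of_isBigO (f := fun u => F (y, u)) le_rfl (continuousAt_slice_snd hJ h0 hF hy)
    (isBigO_slice_succ hU hJ h0 hF hF' hy he ?_)
  have hc := (continuousAt_slice_snd hJ h0 (contDiffOn_fderiv_snd hU hJ hF) hy).sub
    (continuousAt_slice_snd hJ h0 (contDiffOn_fderiv_snd hU hJ hF') hy)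
  simpa using hc.isBigO_one ℝ

end Slices

/-- A continuous bilinear form as a bilinear map. -/
noncomputable def bilToLinear (b : Bil V) : V →ₗ[ℝ] V →ₗ[ℝ] ℝ :=
  LinearMap.mk₂ ℝ (fun X Y => b X Y) (by intros; simp) (by intros; simp) (by intros; simp)
    (by intros; simp)

variable [CompleteSpace V] [FiniteDimensional ℝ V]

/-- In a fixed basis the trace becomes a finite sum of smooth expressions in `Γ` and its derivative,
to each of which `JetEq.comp` applies. -/
theorem ricci_eq_sum (G : V → Bil V) (x Y Z : V) :
    ricci G x Y Z = ∑ i, (LinearMap.toContinuousLinearMap ((Module.finBasis ℝ V).coord i))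
      (curvatureEnd G x Y Z (Module.finBasis ℝ V i)) := by
  rw [ricci_apply, LinearMap.trace_eq_matrix_trace ℝ (Module.finBasis ℝ V), Matrix.trace]
  simp [LinearMap.toMatrix_apply]

theorem metricTrace_eq_sum (b : Bil V) (T : V →ₗ[ℝ] V →ₗ[ℝ] ℝ) :
    metricTrace b T = ∑ i, ∑ j, T (Module.finBasis ℝ V i) (Module.finBasis ℝ V j) *
      LinearMap.toContinuousLinearMap ((Module.finBasis ℝ V).coord i)
        (b.inverse (LinearMap.toContinuousLinearMap ((Module.finBasis ℝ V).coord j))) := by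
  rw [metricTrace, LinearMap.trace_eq_matrix_trace ℝ (Module.finBasis ℝ V), Matrix.trace]
  refine Finset.sum_congr rfl fun i _ => ?_
  have h : LinearMap.toContinuousLinearMap (T (Module.finBasis ℝ V i)) =
      ∑ j, T (Module.finBasis ℝ V i) (Module.finBasis ℝ V j) •
        LinearMap.toContinuousLinearMap ((Module.finBasis ℝ V).coord j) := by
    ext X
    conv_lhs => rw [← (Module.finBasis ℝ V).sum_repr X, LinearMap.coe_toContinuousLinearMap',
      map_sum]
    simp [mul_comm]
  simp [LinearMap.toMatrix_apply, h]

theorem bil_isBigO_of_apply {F : ℝ → Bil V} {φ : ℝ → ℝ}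
    (h : ∀ X Y, (fun u => F u X Y) =O[𝓝 0] φ) : F =O[𝓝 0] φ := by
  set e := Module.finBasis ℝ V
  set C := fun i => LinearMap.toContinuousLinearMap (e.coord i)
  have hF : F = fun u => ∑ i, ∑ j, F u (e i) (e j) • (C i).smulRight (C j) := by
    ext u X Y
    conv_lhs => rw [← e.sum_repr X, ← e.sum_repr Y]
    simp only [map_sum, map_smul, smul_apply, sum_apply, Finset.mul_sum,
      ContinuousLinearMap.smulRight_apply, smul_eq_mul, C, LinearMap.coe_toContinuousLinearMap',
      Module.Basis.coord_apply]
    rw [Finset.sum_comm]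
    exact Finset.sum_congr rfl fun i _ => Finset.sum_congr rfl fun j _ => by ring
  rw [hF]
  refine IsBigO.fun_sum fun i _ => IsBigO.fun_sum fun j _ => ?_
  refine IsBigO.trans (IsBigO.of_bound ‖(C i).smulRight (C j)‖ ?_) (h (e i) (e j))
  simp [norm_smul, mul_comm]

/-- Formal uniqueness of solutions of the ambient equations. -/
theorem ambient_jet_unique (hU : IsOpen U) (hJ : IsOpen J) (h0 : (0 : ℝ) ∈ J)
    {G G' : V × ℝ → Bil V} {f f' : V × ℝ → ℝ}
    (hG : ContDiffOn ℝ ∞ G (U ×ˢ J)) (hG' : ContDiffOn ℝ ∞ G' (U ×ˢ J))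
    (hf : ContDiffOn ℝ ∞ f (U ×ˢ J)) (hf' : ContDiffOn ℝ ∞ f' (U ×ˢ J))
    (hb : ∀ q ∈ U ×ˢ J, (G q).IsInvertible) (hb' : ∀ q ∈ U ×ˢ J, (G' q).IsInvertible)
    (hG0 : ∀ y ∈ U, G (y, 0) = G' (y, 0)) (hf0 : ∀ y ∈ U, f (y, 0) = f' (y, 0))
    (hR : ∀ y ∈ U, ∀ X Y : V, VanishesToInfiniteOrder fun u =>
      weightedRicci (warped G) (fun w => f w.2 - w.1) (0, y, u) (0, X, 0) (0, Y, 0))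
    (hR' : ∀ y ∈ U, ∀ X Y : V, VanishesToInfiniteOrder fun u =>
      weightedRicci (warped G') (fun w => f' w.2 - w.1) (0, y, u) (0, X, 0) (0, Y, 0))
    (hF : ∀ y ∈ U, VanishesToInfiniteOrder fun u =>
      weightedF (warped G) (fun w => f w.2 - w.1) (0, y, u))
    (hF' : ∀ y ∈ U, VanishesToInfiniteOrder fun u =>
      weightedF (warped G') (fun w => f' w.2 - w.1) (0, y, u)) (m : ℕ) :
    ∀ y ∈ U, JetEq (m + 1) (G (y, 0)) (fun u => G (y, u)) (fun u => G' (y, u)) ∧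
      JetEq (m + 1) (f (y, 0)) (fun u => f (y, u)) (fun u => f' (y, u)) := by
  have hS := hU.prod hJ
  induction m with
  | zero =>
    intro y hy
    exact ⟨.one_of_eq hU hJ h0 hG hG' hy (hG0 y hy), .one_of_eq hU hJ h0 hf hf' hy (hf0 y hy)⟩
  | succ m ih =>
    have hm : 1 ≤ m + 1 := by omega
    -- Everything built from spatial derivatives, namely `Γ`, its derivative, `Ric` and `∇²φ`, still
    -- agrees to order `m + 1`.
    have jDG := JetEq.fderiv_slice hm hU hJ h0 hG hG' fun y hy => (ih y hy).1
    have jDf := JetEq.fderiv_slice hm hU hJ h0 hf hf' fun y hy => (ih y hy).2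
    have jDDf := JetEq.fderiv_slice hm hU hJ h0 (contDiffOn_slice_fderiv hS hf)
      (contDiffOn_slice_fderiv hS hf') jDf
    have jΓ : ∀ y ∈ U, JetEq (m + 1) (christoffel (fun x => G (x, 0)) y)
        (fun u => christoffel (fun x => G (x, u)) y)
        (fun u => christoffel (fun x => G' (x, u)) y) := fun y hy =>
      ((ih y hy).1.prodMk (jDG y hy)).comp
        (Φ := fun p : Bil V × (V →L[ℝ] V →L[ℝ] V →L[ℝ] ℝ) => christoffelOf p.1 p.2)
        (contDiffAt_christoffelOf (hb _ ⟨hy, h0⟩) _)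
    have jDΓ := JetEq.fderiv_slice hm hU hJ h0 (contDiffOn_slice_christoffel hS hG hb)
      (contDiffOn_slice_christoffel hS hG' hb') jΓ
    have jRic : ∀ y ∈ U, ∀ X Y, (fun u => ricci (fun x => G (x, u)) y X Y -
        ricci (fun x => G' (x, u)) y X Y) =O[𝓝 0] fun u : ℝ => u ^ (m + 1) := by
      intro y hy X Y
      simp only [ricci_eq_sum, ← Finset.sum_sub_distrib]
      refine IsBigO.fun_sum fun i _ => ?_
      exact (((jDΓ y hy).prodMk (jΓ y hy)).comp
        (Φ := fun p : (V →L[ℝ] V →L[ℝ] V →L[ℝ] V) × (V →L[ℝ] V →L[ℝ] V) =>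
          LinearMap.toContinuousLinearMap ((Module.finBasis ℝ V).coord i)
            (p.1 (Module.finBasis ℝ V i) X Y - p.1 X (Module.finBasis ℝ V i) Y +
              p.2 (Module.finBasis ℝ V i) (p.2 X Y) - p.2 X (p.2 (Module.finBasis ℝ V i) Y)))
        (by fun_prop)).2.2
    have jHess : ∀ y ∈ U, ∀ X Y, JetEq (m + 1)
        (hessian (fun x => G (x, 0)) (fun x => f (x, 0)) y X Y)
        (fun u => hessian (fun x => G (x, u)) (fun x => f (x, u)) y X Y)
        (fun u => hessian (fun x => G' (x, u)) (fun x => f' (x, u)) y X Y) := by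
      intro y hy X Y
      exact ((jDDf y hy).prodMk ((jDf y hy).prodMk (jΓ y hy))).comp
        (Φ := fun p : (V →L[ℝ] V →L[ℝ] ℝ) × (V →L[ℝ] ℝ) × (V →L[ℝ] V →L[ℝ] V) =>
          p.1 X Y - p.2.1 (p.2.2 X Y)) (by fun_prop)
    -- The tensor equation solved for `∂_u G`. It comes first because the scalar equation contains
    -- the trace of `∂_u G`.
    have jdG : ∀ y ∈ U, ∀ X Y, (fun u => fderiv ℝ G (y, u) (0, 1) X Y -
        fderiv ℝ G' (y, u) (0, 1) X Y) =O[𝓝 0] fun u : ℝ => u ^ (m + 1) := by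
      intro y hy X Y
      have h1 := ((jRic y hy X Y).add (jHess y hy X Y).2.2).const_mul_left 2
      have h2 := ((hR y hy X Y (m + 1)).sub (hR' y hy X Y (m + 1))).const_mul_left 2
      refine (h1.sub h2).congr' ?_ EventuallyEq.rfl
      filter_upwards [hJ.mem_nhds h0] with u hu
      rw [weightedRicci_warped_mid hS hG hb hf (z := (0, y, u)) ⟨hy, hu⟩,
        weightedRicci_warped_mid hS hG' hb' hf' (z := (0, y, u)) ⟨hy, hu⟩]
      simp only [weightedRicci, LinearMap.add_apply]
      ring
    intro y hy
    have oG : (fun u => G (y, u) - G' (y, u)) =O[𝓝 0] fun u : ℝ => u ^ (m + 1 + 1) :=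
      isBigO_slice_succ hU hJ h0 hG hG' hy (hG0 y hy) (bil_isBigO_of_apply fun X Y => jdG y hy X Y)
    refine ⟨.of_isBigO (f := fun u => G (y, u)) (by omega)
      (continuousAt_slice_snd hJ h0 hG hy) oG,
      .of_isBigO (f := fun u => f (y, u)) (by omega) (continuousAt_slice_snd hJ h0 hf hy)
        (isBigO_slice_succ hU hJ h0 hf hf' hy (hf0 y hy) ?_)⟩
    have jdG' (X Y : V) := JetEq.of_isBigO (f := fun u => fderiv ℝ G (y, u) (0, 1) X Y) hm
      (((continuousAt_slice_snd hJ h0 (contDiffOn_fderiv_snd hU hJ hG) hy).clm_apply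
        continuousAt_const).clm_apply continuousAt_const) (jdG y hy X Y)
    set T : ℝ → V →ₗ[ℝ] V →ₗ[ℝ] ℝ := fun u =>
      hessian (fun x => G (x, u)) (fun x => f (x, u)) y -
        (2⁻¹ : ℝ) • bilToLinear (fderiv ℝ G (y, u) (0, 1)) with hT
    set T' : ℝ → V →ₗ[ℝ] V →ₗ[ℝ] ℝ := fun u =>
      hessian (fun x => G' (x, u)) (fun x => f' (x, u)) y -
        (2⁻¹ : ℝ) • bilToLinear (fderiv ℝ G' (y, u) (0, 1)) with hT'
    have htr : (fun u => metricTrace (G (y, u)) (T u) - metricTrace (G' (y, u)) (T' u)) =O[𝓝 0]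
        fun u : ℝ => u ^ (m + 1) := by
      simp only [metricTrace_eq_sum, ← Finset.sum_sub_distrib]
      refine IsBigO.fun_sum fun i _ => IsBigO.fun_sum fun j _ => ?_
      refine (((ih y hy).1.prodMk ((jHess y hy _ _).prodMk (jdG' _ _))).comp
        (Φ := fun p : Bil V × ℝ × ℝ => (p.2.1 - 2⁻¹ * p.2.2) *
          LinearMap.toContinuousLinearMap ((Module.finBasis ℝ V).coord i)
            (p.1.inverse (LinearMap.toContinuousLinearMap ((Module.finBasis ℝ V).coord j))))
        ?_).2.2
      refine ContDiffAt.mul (by fun_prop) ?_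
      refine (ContinuousLinearMap.contDiff _).contDiffAt.comp _ (ContDiffAt.clm_apply ?_
        contDiffAt_const)
      exact ContDiffAt.comp (g := ContinuousLinearMap.inverse) _
        (hb (y, 0) ⟨hy, h0⟩).contDiffAt_map_inverse contDiffAt_fst
    have hgs : (fun u => gradSq (fun x => G (x, u)) (fun x => f (x, u)) y -
        gradSq (fun x => G' (x, u)) (fun x => f' (x, u)) y) =O[𝓝 0]
        fun u : ℝ => u ^ (m + 1) := by
      refine (((ih y hy).1.prodMk (jDf y hy)).comp
        (Φ := fun p : Bil V × (V →L[ℝ] ℝ) => p.2 (p.1.inverse p.2)) ?_).2.2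
      refine contDiffAt_snd.clm_apply (ContDiffAt.clm_apply ?_ contDiffAt_snd)
      exact ContDiffAt.comp (g := ContinuousLinearMap.inverse) _
        (hb (y, 0) ⟨hy, h0⟩).contDiffAt_map_inverse contDiffAt_fst
    -- The scalar equation solved for `∂_u f`.
    have h1 := (((hF y hy (m + 1)).sub (hF' y hy (m + 1))).sub htr).add hgs |>.const_mul_left (2⁻¹)
    refine h1.congr' ?_ EventuallyEq.rfl
    filter_upwards [hJ.mem_nhds h0] with u hu
    rw [weightedF_warped hS hG hb hf (z := (0, y, u)) ⟨hy, hu⟩ (T u) fun X Y => rfl,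
      weightedF_warped hS hG' hb' hf' (z := (0, y, u)) ⟨hy, hu⟩ (T' u) fun X Y => rfl]
    ring

end JetUniqueness
end WeightedAmbient

namespace WeightedAmbient

open Filter Asymptotics Topology

/-! ### Riemannian metrics in charts and their rescaling -/

section Charts

variable {n : ℕ} {M : Type*} [TopologicalSpace M] [ChartedSpace (Euc n) M] [IsManifold (𝓡 n) ∞ M]

theorem ambientMetric_eq_warped (g : ℝ → Metric n M) (p : M) :
    ambientMetric g p = warped fun q => coordMetric (g q.2) p q.1 := rfl

theorem ambientPotential_eq (φ : ℝ → M → ℝ) (p : M) :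
    ambientPotential φ p = fun w => (fun q : Euc n × ℝ => coordFun (φ q.2) p q.1) w.2 - w.1 := rfl

theorem coordMetric_apply (g : Metric n M) (p : M) (y X Y : Euc n) :
    coordMetric g p y X Y = g.inner ((extChartAt (𝓡 n) p).symm y)
      (mfderiv 𝓘(ℝ, Euc n) (𝓡 n) (extChartAt (𝓡 n) p).symm y X)
      (mfderiv 𝓘(ℝ, Euc n) (𝓡 n) (extChartAt (𝓡 n) p).symm y Y) := rfl

theorem isInvertible_mfderiv_extChartAt_symm {p : M} {y : Euc n}
    (hy : y ∈ (extChartAt (𝓡 n) p).target) :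
    (mfderiv 𝓘(ℝ, Euc n) (𝓡 n) (extChartAt (𝓡 n) p).symm y).IsInvertible := by
  have : IsManifold (𝓡 n) 1 M := .of_le (n := ∞) (by simp)
  have := isInvertible_mfderivWithin_extChartAt_symm (I := 𝓡 n) hy
  rwa [ModelWithCorners.range_eq_univ, mfderivWithin_univ] at this

theorem coordMetric_symm (g : Metric n M) (p : M) (y X Y : Euc n) :
    coordMetric g p y X Y = coordMetric g p y Y X := by
  rw [coordMetric_apply, coordMetric_apply, g.symm]

theorem coordMetric_pos (g : Metric n M) {p : M} {y : Euc n}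
    (hy : y ∈ (extChartAt (𝓡 n) p).target) {X : Euc n} (hX : X ≠ 0) :
    0 < coordMetric g p y X X := by
  refine g.pos _ _ fun h => hX ?_
  obtain ⟨e, he⟩ := isInvertible_mfderiv_extChartAt_symm hy
  rw [← he] at h
  exact e.map_eq_zero_iff.1 h

theorem coordMetric_isInvertible (g : Metric n M) {p : M} {y : Euc n}
    (hy : y ∈ (extChartAt (𝓡 n) p).target) : (coordMetric g p y).IsInvertible := by
  have hinj : Function.Injective
      (LinearMap.toContinuousLinearMap.symm.toLinearMap ∘ₗ (coordMetric g p y).toLinearMap :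
        Euc n →ₗ[ℝ] Module.Dual ℝ (Euc n)) := by
    rw [injective_iff_map_eq_zero]
    intro X hX
    by_contra h0
    have h1 := coordMetric_pos g hy h0
    have h2 := LinearMap.congr_fun hX X
    exact h1.ne' h2
  let e := LinearEquiv.ofInjectiveOfFinrankEq _ hinj (by rw [Subspace.dual_finrank_eq])
  refine ⟨(e.trans LinearMap.toContinuousLinearMap).toContinuousLinearEquiv, ?_⟩
  ext X Y
  rfl

/-- On the chart domain the derivative of the inverse chart is the inverse of the tangent bundle
trivialization at `p`. The coefficients are therefore `g` evaluated on smooth local sections. -/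
theorem coordMetric_contDiffOn (g : Metric n M) (p : M) :
    ContDiffOn ℝ ∞ (coordMetric g p) (extChartAt (𝓡 n) p).target := by
  have : IsManifold (𝓡 n) 1 M := .of_le (n := ∞) (by simp)
  rw [contDiffOn_clm_apply]
  intro X
  rw [contDiffOn_clm_apply]
  intro Y
  set e := trivializationAt (Euc n) (TangentSpace (𝓡 n) (M := M)) p
  have hV (X : Euc n) : ContMDiffOn (𝓡 n) ((𝓡 n).prod 𝓘(ℝ, Euc n)) ∞
      (fun x => Bundle.TotalSpace.mk' (Euc n) (E := TangentSpace (𝓡 n)) x (e.symmL ℝ x X))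
      (chartAt (Euc n) p).source := by
    have h1 := (e.contMDiffOn_symmL (n := ∞) (𝕜 := ℝ) (IB := 𝓡 n))
    have h2 : ContMDiffOn (𝓡 n) ((𝓡 n).prod 𝓘(ℝ, Euc n)) ∞ (fun x : M => Bundle.TotalSpace.mk'
        (Euc n) (E := Bundle.Trivial M (Euc n)) x X) (chartAt (Euc n) p).source := by
      intro x _
      rw [Bundle.contMDiffWithinAt_section]
      exact contMDiffWithinAt_const
    exact ContMDiffOn.clm_bundle_apply (b := fun x => x) h1 h2
  have h1 := ContMDiffOn.clm_bundle_apply₂ (s := (chartAt (Euc n) p).source) (b := fun x => x)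
    (F₃ := ℝ) (E₃ := Bundle.Trivial M ℝ) g.contMDiff.contMDiffOn (hV X) (hV Y)
  have h2 : ContMDiffOn (𝓡 n) 𝓘(ℝ, ℝ) ∞
      (fun x => g.inner x (e.symmL ℝ x X) (e.symmL ℝ x Y)) (chartAt (Euc n) p).source := by
    intro x hx
    have := h1 x hx
    rw [Bundle.contMDiffWithinAt_section] at this
    exact this
  have h3 := h2.comp (contMDiffOn_extChartAt_symm (I := 𝓡 n) (n := ∞) p) fun y hy => by
    simpa using (extChartAt (𝓡 n) p).map_target hy
  rw [contMDiffOn_iff_contDiffOn] at h3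
  refine h3.congr fun y hy => ?_
  have hy' : (extChartAt (𝓡 n) p).symm y ∈ (chartAt (Euc n) p).source := by
    simpa using (extChartAt (𝓡 n) p).map_target hy
  have h4 := TangentBundle.symmL_trivializationAt (𝕜 := ℝ) (I := 𝓡 n) hy'
  rw [(extChartAt (𝓡 n) p).right_inv hy, ModelWithCorners.range_eq_univ, mfderivWithin_univ] at h4
  rw [coordMetric_apply, Function.comp_apply, h4]
  rfl

theorem metric_ext {g g' : Metric n M} (h : ∀ x X Y, g.inner x X Y = g'.inner x X Y) : g = g' := by
  have : g.inner = g'.inner := by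
    funext x
    ext X Y
    exact h x X Y
  cases g; cases g'
  congr

theorem inner_eq_of_coordMetric {g g' : Metric n M} {s : ℝ} {x : M}
    (h : ∀ X Y, coordMetric g x (extChartAt (𝓡 n) x x) X Y =
      s * coordMetric g' x (extChartAt (𝓡 n) x x) X Y) (X Y : TangentSpace (𝓡 n) x) :
    g.inner x X Y = s * g'.inner x X Y := by
  obtain ⟨e, he⟩ := isInvertible_mfderiv_extChartAt_symm (mem_extChartAt_target (I := 𝓡 n) x)
  have hA (X : TangentSpace (𝓡 n) ((extChartAt (𝓡 n) x).symm (extChartAt (𝓡 n) x x))) :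
      ∃ a : Euc n, mfderiv 𝓘(ℝ, Euc n) (𝓡 n) (extChartAt (𝓡 n) x).symm (extChartAt (𝓡 n) x x) a = X :=
    ⟨e.symm X, by rw [← he]; exact e.apply_symm_apply X⟩
  -- The base point is only propositionally equal to `x`, and the tangent space depends on it;
  -- stating the claim as a predicate on `M` permits the rewrite.
  let P : M → Prop := fun x => ∀ X Y : TangentSpace (𝓡 n) x, g.inner x X Y = s * g'.inner x X Y
  have key : P ((extChartAt (𝓡 n) x).symm (extChartAt (𝓡 n) x x)) := by
    intro X Y
    obtain ⟨a, rfl⟩ := hA X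
    obtain ⟨b, rfl⟩ := hA Y
    exact h a b
  rw [extChartAt_to_inv] at key
  exact key X Y

/-- The metric `s g`. -/
noncomputable def scaleMetric (g : Metric n M) (s : ℝ) (hs : 0 < s) : Metric n M where
  inner x := s • g.inner x
  symm x v w := by simp [g.symm x v w]
  pos x v hv := by simpa using mul_pos hs (g.pos x v hv)
  isVonNBounded x := by
    -- The unit ball of `s g` is contained in the image of the unit ball of `g` under `(√s)⁻¹`.
    refine ((g.isVonNBounded x).image
      ((√s)⁻¹ • ContinuousLinearMap.id ℝ (TangentSpace (𝓡 n) x))).subset fun v hv => ?_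
    have hs' : √s ≠ 0 := (Real.sqrt_pos.2 hs).ne'
    refine ⟨√s • v, ?_, by simp [smul_smul, hs']⟩
    have : √s * (√s * g.inner x v v) = s * g.inner x v v := by
      rw [← mul_assoc, Real.mul_self_sqrt hs.le]
    simpa [this] using hv
  contMDiff := by
    exact g.contMDiff.const_smul_section

theorem scaleMetric_inner (g : Metric n M) {s : ℝ} (hs : 0 < s) (x : M)
    (X Y : TangentSpace (𝓡 n) x) : (scaleMetric g s hs).inner x X Y = s * g.inner x X Y := rfl

theorem coordMetric_scaleMetric (g : Metric n M) {s : ℝ} (hs : 0 < s) (p : M) (y : Euc n) :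
    coordMetric (scaleMetric g s hs) p y = s • coordMetric g p y := by
  ext X Y
  rw [coordMetric_apply, scaleMetric_inner]
  rfl

end Charts
end WeightedAmbient

namespace WeightedAmbient

open Filter Asymptotics Topology

/-! ### The Einstein ambient space and invariance of the volume coefficients -/

section EinsteinAmbient

set_option maxSynthPendingDepth 3

variable {n : ℕ} {M : Type*} [TopologicalSpace M] [ChartedSpace (Euc n) M] [IsManifold (𝓡 n) ∞ M]

theorem isSmoothFamily_of_scaled {g : Metric n M} {J : Set ℝ} {a b : ℝ → ℝ}
    (ha : ContDiffOn ℝ ∞ a J) (hb : ContDiffOn ℝ ∞ b J) {gs : ℝ → Metric n M} {φ : ℝ → M → ℝ}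
    (hg : ∀ u ∈ J, ∀ p : M, ∀ y ∈ (extChartAt (𝓡 n) p).target,
      coordMetric (gs u) p y = a u • coordMetric g p y)
    (hφ : ∀ u ∈ J, ∀ x, φ u x = b u) : IsSmoothFamily J gs φ := by
  intro p
  constructor
  · refine ContDiffOn.congr ?_ fun z hz => hg z.2 hz.2 p z.1 hz.1
    exact (ha.comp contDiffOn_snd fun z hz => hz.2).smul
      ((coordMetric_contDiffOn g p).comp contDiffOn_fst fun z hz => hz.1)
  · have h1 : ContDiffOn ℝ ∞ (fun z : Euc n × ℝ => b z.2) ((extChartAt (𝓡 n) p).target ×ˢ J) :=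
      hb.comp contDiffOn_snd fun z hz => hz.2
    exact h1.congr fun z hz => hφ z.2 hz.2 _

/-- The family `(1 + κ u) g`. -/
noncomputable def einsteinMetric (g : Metric n M) (κ u : ℝ) : Metric n M :=
  if h : 0 < 1 + κ * u then scaleMetric g (1 + κ * u) h else g

variable (M) in
/-- The constant functions `(n / 4) log (1 + κ u) + c`. -/
noncomputable def einsteinPotential (n : ℕ) (κ c u : ℝ) : M → ℝ :=
  fun _ => (n : ℝ) / 4 * Real.log (1 + κ * u) + c

theorem einsteinMetric_of_pos (g : Metric n M) {κ u : ℝ} (h : 0 < 1 + κ * u) :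
    einsteinMetric g κ u = scaleMetric g (1 + κ * u) h := by simp [einsteinMetric, h]

theorem coordMetric_einsteinMetric (g : Metric n M) {κ u : ℝ} (h : 0 < 1 + κ * u) (p : M)
    (y : Euc n) : coordMetric (einsteinMetric g κ u) p y = (1 + κ * u) • coordMetric g p y := by
  rw [einsteinMetric_of_pos g h, coordMetric_scaleMetric]

theorem isOpen_one_add_mul_pos (κ : ℝ) : IsOpen {u : ℝ | 0 < 1 + κ * u} :=
  isOpen_lt continuous_const (by fun_prop)

theorem eventually_one_add_mul_pos (κ : ℝ) : ∀ᶠ u in 𝓝 (0 : ℝ), 0 < 1 + κ * u :=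
  (isOpen_one_add_mul_pos κ).mem_nhds (by simp)

theorem ordConnected_one_add_mul_pos (κ : ℝ) : {u : ℝ | 0 < 1 + κ * u}.OrdConnected := by
  refine Set.ordConnected_def.2 fun a ha b hb u hu => ?_
  simp only [Set.mem_ofPred_eq] at *
  rcases le_total 0 κ with h | h
  · nlinarith [mul_le_mul_of_nonneg_left hu.1 h]
  · nlinarith [mul_le_mul_of_nonpos_left hu.2 h]

theorem contDiffOn_log_one_add_mul (κ a c : ℝ) :
    ContDiffOn ℝ ∞ (fun u : ℝ => a * Real.log (1 + κ * u) + c) {u | 0 < 1 + κ * u} :=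
  (contDiffOn_const.mul (ContDiffOn.log (by fun_prop) fun _ hu => ne_of_gt hu)).add contDiffOn_const

theorem einstein_ambient_equations {g : Metric n M} {κ : ℝ} (hg : IsEinstein g (κ / 2)) (c : ℝ)
    (p : M) {y : Euc n} (hy : y ∈ (extChartAt (𝓡 n) p).target) (v : ℝ) {u : ℝ}
    (hu : 0 < 1 + κ * u) :
    (∀ ξ η, weightedRicci (ambientMetric (einsteinMetric g κ) p)
      (ambientPotential (einsteinPotential M n κ c) p) (v, y, u) ξ η = 0) ∧
      weightedF (ambientMetric (einsteinMetric g κ) p)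
        (ambientPotential (einsteinPotential M n κ c) p) (v, y, u) = 0 := by
  rw [ambientMetric_eq_warped, ambientPotential_eq]
  have hS := coordMetric_contDiffOn g p
  have hb : ∀ y ∈ (extChartAt (𝓡 n) p).target, (coordMetric g p y).IsInvertible :=
    fun _ hy => coordMetric_isInvertible g hy
  have hs : ∀ y ∈ (extChartAt (𝓡 n) p).target, ∀ X Y,
    coordMetric g p y X Y = coordMetric g p y Y X := fun y _ => coordMetric_symm g p y
  have hE := hg p
  refine ambient_equations_of_einstein (V := Euc n) (U := (extChartAt (𝓡 n) p).target)
    (J := {u | 0 < 1 + κ * u}) (κ := κ) (c := c) (G₀ := coordMetric g p)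
    (G := fun q : Euc n × ℝ => coordMetric (einsteinMetric g κ q.2) p q.1)
    (f := fun q : Euc n × ℝ => coordFun (einsteinPotential M n κ c q.2) p q.1)
    (isOpen_extChartAt_target p)
    (isOpen_one_add_mul_pos κ) (fun _ hu => hu) hS hb hs hE ?_ ?_ hy hu
  · exact fun q hq => coordMetric_einsteinMetric g hq.2 p q.1
  · intro q _
    rw [finrank_euclideanSpace_fin]
    rfl

theorem VanishesToInfiniteOrder.of_eventually {r : ℝ → ℝ} (h : ∀ᶠ u in 𝓝 0, r u = 0) :
    VanishesToInfiniteOrder r := fun _ =>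
  (isBigO_zero _ _).congr' (h.mono fun _ hu => hu.symm) EventuallyEq.rfl

/-- The explicit normal weighted ambient space of an Einstein metric with constant potential. -/
noncomputable def einsteinAmbient {g : Metric n M} {κ : ℝ} (hg : IsEinstein g (κ / 2)) (c : ℝ) :
    NormalAmbientSpace g (fun _ => c) where
  dom := {u | 0 < 1 + κ * u}
  isOpen_dom := isOpen_one_add_mul_pos κ
  ordConnected_dom := ordConnected_one_add_mul_pos κ
  zero_mem_dom := by change 0 < 1 + κ * 0; simp
  metric := einsteinMetric g κ
  potential := einsteinPotential M n κ c
  metric_zero := by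
    rw [einsteinMetric_of_pos g (by simp)]
    exact metric_ext fun x X Y => by simp [scaleMetric_inner]
  potential_zero := by funext x; simp [einsteinPotential]
  smooth := isSmoothFamily_of_scaled (g := g) (a := fun u => 1 + κ * u)
    (b := fun u => n / 4 * Real.log (1 + κ * u) + c) (by fun_prop)
    (contDiffOn_log_one_add_mul κ _ c)
    (fun u hu p y _ => coordMetric_einsteinMetric g hu p y) (fun _ _ _ => rfl)
  ricci_vanishes p y hy v ξ η := .of_eventually <|
    (eventually_one_add_mul_pos κ).mono fun u hu =>
      (einstein_ambient_equations hg c p hy v hu).1 ξ η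
  F_vanishes p y hy v := .of_eventually <|
    (eventually_one_add_mul_pos κ).mono fun u hu =>
      (einstein_ambient_equations hg c p hy v hu).2

theorem einsteinAmbient_isGlobal {g : Metric n M} {κ : ℝ} (hg : IsEinstein g (κ / 2)) (c : ℝ) :
    (einsteinAmbient hg c).IsGlobal := fun p _ hy v _ hu => einstein_ambient_equations hg c p hy v hu

theorem analyticOnNhd_log_one_add_mul (κ a c : ℝ) {J : Set ℝ} (hJ : ∀ u ∈ J, 0 < 1 + κ * u) :
    AnalyticOnNhd ℝ (fun u : ℝ => a * Real.log (1 + κ * u) + c) J := by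
  intro u hu
  have h1 : AnalyticAt ℝ (fun u : ℝ => 1 + κ * u) u := by fun_prop
  exact (analyticAt_const.mul (h1.log (hJ u hu))).add analyticAt_const

theorem einsteinAmbient_isAnalytic {g : Metric n M} {κ : ℝ} (hg : IsEinstein g (κ / 2)) (c : ℝ) :
    (einsteinAmbient hg c).IsAnalytic := by
  refine fun x => ⟨fun X Y => ?_, analyticOnNhd_log_one_add_mul κ _ c fun _ hu => hu⟩
  have h1 : AnalyticOnNhd ℝ (fun u => (1 + κ * u) * g.inner x X Y) {u | 0 < 1 + κ * u} :=
    fun u _ => by fun_prop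
  refine h1.congr (isOpen_one_add_mul_pos κ) fun u (hu : 0 < 1 + κ * u) => ?_
  change _ = (einsteinMetric g κ u).inner x X Y
  rw [einsteinMetric_of_pos g hu, scaleMetric_inner]

namespace NormalAmbientSpace

variable {g : Metric n M} {φ : M → ℝ}

/-- Two normal ambient spaces of the same structure agree to infinite order. -/
theorem jetEq (A B : NormalAmbientSpace g φ) (m : ℕ) {p : M} {y : Euc n}
    (hy : y ∈ (extChartAt (𝓡 n) p).target) :
    JetEq (m + 1) (coordMetric g p y) (fun u => coordMetric (A.metric u) p y)
      (fun u => coordMetric (B.metric u) p y) ∧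
    JetEq (m + 1) (coordFun φ p y) (fun u => coordFun (A.potential u) p y)
      (fun u => coordFun (B.potential u) p y) := by
  have hsub (C : NormalAmbientSpace g φ) (h : A.dom ∩ B.dom ⊆ C.dom) :=
    Set.prod_mono_right (s := (extChartAt (𝓡 n) p).target) h
  have hA := hsub A Set.inter_subset_left
  have hB := hsub B Set.inter_subset_right
  have := ambient_jet_unique (isOpen_extChartAt_target p) (A.isOpen_dom.inter B.isOpen_dom)
    ⟨A.zero_mem_dom, B.zero_mem_dom⟩ ((A.smooth p).1.mono hA) ((B.smooth p).1.mono hB)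
    ((A.smooth p).2.mono hA) ((B.smooth p).2.mono hB)
    (fun q hq => coordMetric_isInvertible _ hq.1) (fun q hq => coordMetric_isInvertible _ hq.1)
    (fun y _ => by simp only [A.metric_zero, B.metric_zero])
    (fun y _ => by simp only [A.potential_zero, B.potential_zero])
    (fun y hy X Y => A.ricci_vanishes p y hy 0 _ _) (fun y hy X Y => B.ricci_vanishes p y hy 0 _ _)
    (fun y hy => A.F_vanishes p y hy 0) (fun y hy => B.F_vanishes p y hy 0) m y hy
  simpa only [A.metric_zero, A.potential_zero] using this

end NormalAmbientSpace

/-- The determinant of a bilinear form in the standard basis. -/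
noncomputable def bilDet (b : Bil (Euc n)) : ℝ :=
  Matrix.det (Matrix.of fun i j : Fin n => b (EuclideanSpace.single i 1) (EuclideanSpace.single j 1))

theorem gramDet_eq_bilDet (g : Metric n M) (p : M) (y : Euc n) :
    gramDet g p y = bilDet (coordMetric g p y) := rfl

theorem bilDet_contDiff : ContDiff ℝ ∞ (bilDet (n := n)) := by
  have : bilDet (n := n) = fun b => ∑ σ : Equiv.Perm (Fin n), ((Equiv.Perm.sign σ : ℤ) : ℝ) *
      ∏ i, b (EuclideanSpace.single (σ i) 1) (EuclideanSpace.single i 1) := by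
    ext b
    rw [bilDet, Matrix.det_apply']
    simp
  rw [this]
  refine ContDiff.sum fun σ _ => contDiff_const.mul (contDiff_prod fun i _ => ?_)
  exact (contDiff_id.clm_apply contDiff_const).clm_apply contDiff_const

theorem bilDet_smul (s : ℝ) (b : Bil (Euc n)) : bilDet (s • b) = s ^ n * bilDet b := by
  have : (Matrix.of fun i j : Fin n => (s • b) (EuclideanSpace.single i 1)
      (EuclideanSpace.single j 1)) = s • Matrix.of fun i j : Fin n =>
      b (EuclideanSpace.single i 1) (EuclideanSpace.single j 1) := by
    ext i j; simp
  rw [bilDet, this, Matrix.det_smul, Fintype.card_fin, bilDet]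

theorem gramDet_pos (g : Metric n M) {p : M} {y : Euc n}
    (hy : y ∈ (extChartAt (𝓡 n) p).target) : 0 < gramDet g p y := by
  refine Matrix.PosDef.det_pos (Matrix.PosDef.of_dotProduct_mulVec_pos ?_ fun v hv => ?_)
  · ext i j
    simpa using coordMetric_symm g p y _ _
  · set X : Euc n := ∑ i, v i • EuclideanSpace.single i (1 : ℝ) with hX
    have hXv (i : Fin n) : X i = v i := by simp [hX, Pi.single_apply]
    have hX0 : X ≠ 0 := fun h => hv (funext fun i => by rw [← hXv, h]; rfl)
    have h := coordMetric_pos g hy hX0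
    have h2 : coordMetric g p y X X = star v ⬝ᵥ (Matrix.of fun i j : Fin n =>
        coordMetric g p y (EuclideanSpace.single i 1) (EuclideanSpace.single j 1)).mulVec v := by
      simp only [hX, map_sum, map_smul, sum_apply, smul_apply, dotProduct, Matrix.mulVec,
        Finset.mul_sum, smul_eq_mul]
      rw [Finset.sum_comm]
      refine Finset.sum_congr rfl fun i _ => Finset.sum_congr rfl fun j _ => ?_
      simp
      ring
    rwa [h2] at h

theorem gramDet_scaleMetric (g : Metric n M) {s : ℝ} (hs : 0 < s) (p : M) (y : Euc n) :
    gramDet (scaleMetric g s hs) p y = s ^ n * gramDet g p y := by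
  rw [gramDet_eq_bilDet, coordMetric_scaleMetric, bilDet_smul, gramDet_eq_bilDet]

namespace NormalAmbientSpace

variable {g : Metric n M} {φ : M → ℝ}

/-- The renormalized volume is one fixed function `Φ` of `(g_u, φ_u)`, smooth near the initial data,
so its Taylor coefficients at `0` depend only on the jets of the ambient space. -/
theorem volumeCoeff_eq (A B : NormalAmbientSpace g φ) (k : ℕ) (x : M) :
    A.volumeCoeff k x = B.volumeCoeff k x := by
  have hy := mem_extChartAt_target (I := 𝓡 n) x
  have hd := gramDet_pos g hy
  set y := extChartAt (𝓡 n) x x with hydef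
  obtain ⟨Φ, hΦ⟩ : ∃ Φ : Bil (Euc n) × ℝ → ℝ, Φ = fun q =>
    Real.exp (-q.2) / Real.exp (-φ x) * √(bilDet q.1 / gramDet g x y) := ⟨_, rfl⟩
  have hφx : coordFun φ x y = φ x := by simp [coordFun, hydef]
  have hcoord (C : NormalAmbientSpace g φ) : C.renormalizedVolume x =
      fun u => Φ (coordMetric (C.metric u) x y, coordFun (C.potential u) x y) := by
    funext u
    simp [renormalizedVolume, hΦ, gramDet_eq_bilDet, coordFun, hydef]
  have hΦC : ContDiffAt ℝ ∞ Φ (coordMetric g x y, coordFun φ x y) := by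
    rw [hΦ]
    -- The square root is smooth here since its argument equals `1` at the initial data.
    refine ContDiffAt.mul (by fun_prop) (ContDiffAt.sqrt ?_ ?_)
    · exact (bilDet_contDiff.contDiffAt.comp _ contDiffAt_fst).div_const _
    · rw [← gramDet_eq_bilDet, div_self hd.ne']
      exact one_ne_zero
  have hsm (C : NormalAmbientSpace g φ) : ContDiffAt ℝ ∞ (C.renormalizedVolume x) 0 := by
    rw [hcoord]
    have hnh := C.isOpen_dom.mem_nhds C.zero_mem_dom
    have h1 : ContDiffAt ℝ ∞ (fun u => coordMetric (C.metric u) x y) 0 :=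
      (contDiffOn_slice_snd (F := fun z : Euc n × ℝ => coordMetric (C.metric z.2) x z.1)
        (C.smooth x).1 hy).contDiffAt hnh
    have h2 : ContDiffAt ℝ ∞ (fun u => coordFun (C.potential u) x y) 0 :=
      (contDiffOn_slice_snd (F := fun z : Euc n × ℝ => coordFun (C.potential z.2) x z.1)
        (C.smooth x).2 hy).contDiffAt hnh
    refine ContDiffAt.comp (g := Φ)
      (f := fun u => (coordMetric (C.metric u) x y, coordFun (C.potential u) x y)) (0 : ℝ) ?_
      (h1.prodMk h2)
    rw [C.metric_zero, C.potential_zero]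
    exact hΦC
  rw [volumeCoeff, volumeCoeff, iteratedDeriv_eq_of_isBigO_pow (hsm A) (hsm B) fun m => ?_]
  have hj := jetEq A B m hy
  have := ((hj.1.prodMk hj.2).comp (hΦC.of_le (by simp))).2.2
  rw [hcoord, hcoord]
  refine this.trans (IsBigO.of_bound 1 ?_)
  filter_upwards [Metric.closedBall_mem_nhds (0 : ℝ) one_pos] with u hu
  rw [norm_pow, norm_pow, one_mul]
  exact pow_le_pow_of_le_one (norm_nonneg _) (by simpa using hu) (Nat.le_succ m)

end NormalAmbientSpace

end EinsteinAmbient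
end WeightedAmbient

namespace WeightedAmbient

open Filter Asymptotics Topology

/-! ### Analytic uniqueness, volume coefficients and the explicit flow -/

section EinsteinFlow

set_option maxSynthPendingDepth 3

/-- Infinite-order contact makes the power series of the difference at `0` zero; the identity
theorem spreads equality over the interval. -/
theorem AnalyticOnNhd.eqOn_of_isBigO_pow {f g : ℝ → ℝ} {J : Set ℝ} (hf : AnalyticOnNhd ℝ f J)
    (hg : AnalyticOnNhd ℝ g J) (hJ : J.OrdConnected) (h0 : (0 : ℝ) ∈ J)
    (h : ∀ m : ℕ, (fun u => f u - g u) =O[𝓝 0] fun u : ℝ => u ^ (m + 1)) : Set.EqOn f g J := by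
  refine hf.eqOn_of_preconnected_of_eventuallyEq hg hJ.isPreconnected h0 ?_
  have ha : AnalyticAt ℝ (fun u => f u - g u) 0 := (hf 0 h0).sub (hg 0 h0)
  have hp := ha.hasFPowerSeriesAt
  have hz (n : ℕ) : iteratedDeriv n (fun u => f u - g u) 0 = 0 :=
    iteratedDeriv_eq_zero_of_isBigO_pow ha.contDiffAt (h n) n (by omega)
  have : (fun n => iteratedDeriv n (fun u => f u - g u) 0 / (n.factorial : ℝ)) = 0 := by
    funext n; simp [hz]
  have h0 : FormalMultilinearSeries.ofScalars ℝ (0 : ℕ → ℝ) = 0 :=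
    funext fun n => FormalMultilinearSeries.ofScalars_eq_zero_of_scalar_zero _ rfl
  rw [this, h0] at hp
  exact hp.eventually_eq_zero.mono fun u hu => sub_eq_zero.1 hu

theorem iteratedDeriv_one_add_mul_rpow (κ a : ℝ) (k : ℕ) {u : ℝ} (hu : 0 < 1 + κ * u) :
    iteratedDeriv k (fun u => (1 + κ * u) ^ a) u =
      κ ^ k * (∏ i ∈ Finset.range k, (a - i)) * (1 + κ * u) ^ (a - k) := by
  induction k generalizing u with
  | zero => simp
  | succ k ih =>
    rw [iteratedDeriv_succ]
    have e : iteratedDeriv k (fun u => (1 + κ * u) ^ a) =ᶠ[𝓝 u] fun u =>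
        κ ^ k * (∏ i ∈ Finset.range k, (a - i)) * (1 + κ * u) ^ (a - k) := by
      filter_upwards [(isOpen_one_add_mul_pos κ).mem_nhds hu] with s hs using ih hs
    rw [e.deriv_eq]
    have h1 : HasDerivAt (fun u => 1 + κ * u) κ u := by
      simpa using ((hasDerivAt_id u).const_mul κ).const_add 1
    have h2 := (h1.rpow_const (p := a - k) (Or.inl hu.ne')).const_mul
      (κ ^ k * (∏ i ∈ Finset.range k, (a - i)))
    rw [h2.deriv, Finset.prod_range_succ]
    push_cast
    rw [show a - (k + 1 : ℝ) = a - k - 1 by ring]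
    ring

variable {n : ℕ} {M : Type*} [TopologicalSpace M] [ChartedSpace (Euc n) M] [IsManifold (𝓡 n) ∞ M]
variable {g : Metric n M} {κ c : ℝ}

/-- Used with `b = n/4`, where it gives the renormalized volume, and with `b = n/2`, where the
exponent vanishes and the weighted measure is constant along the flow. -/
theorem exp_mul_sqrt_pow {a : ℝ} (ha : 0 < a) (b : ℝ) (n : ℕ) :
    Real.exp (-(b * Real.log a)) * √(a ^ n) = a ^ ((n : ℝ) / 2 - b) := by
  rw [Real.rpow_def_of_pos ha, Real.sqrt_eq_rpow, ← Real.rpow_natCast, ← Real.rpow_mul ha.le,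
    Real.rpow_def_of_pos ha, ← Real.exp_add]
  congr 1
  ring

/-- Binomial series of `(1 + κu)^(n/4)`: the determinant contributes the exponent `n/2`, the density
takes off `n/4`. -/
theorem volumeCoeff_einsteinAmbient (hg : IsEinstein g (κ / 2)) (c : ℝ) (k : ℕ) (x : M) :
    (einsteinAmbient hg c).volumeCoeff k x =
      (κ / 4) ^ k / (k.factorial : ℝ) * ∏ i ∈ Finset.range k, ((n : ℝ) - 4 * i) := by
  have e : (einsteinAmbient hg c).renormalizedVolume x =ᶠ[𝓝 0]
      fun u => (1 + κ * u) ^ ((n : ℝ) / 4) := by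
    filter_upwards [eventually_one_add_mul_pos κ] with u hu
    have hd := gramDet_pos g (mem_extChartAt_target (I := 𝓡 n) x)
    change Real.exp (-((n : ℝ) / 4 * Real.log (1 + κ * u) + c)) / Real.exp (-c) *
      √(gramDet (einsteinMetric g κ u) x (extChartAt (𝓡 n) x x) / gramDet g x (extChartAt (𝓡 n) x x))
      = _
    rw [einsteinMetric_of_pos g hu, gramDet_scaleMetric, mul_div_assoc, div_self hd.ne', mul_one,
      ← Real.exp_sub, show -((n : ℝ) / 4 * Real.log (1 + κ * u) + c) - -c =
        -((n : ℝ) / 4 * Real.log (1 + κ * u)) by ring, exp_mul_sqrt_pow hu]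
    congr 1
    ring
  rw [NormalAmbientSpace.volumeCoeff, e.iteratedDeriv_eq, iteratedDeriv_one_add_mul_rpow κ _ k (by simp)]
  have h4 : ∏ i ∈ Finset.range k, ((n : ℝ) - 4 * i) =
      4 ^ k * ∏ i ∈ Finset.range k, ((n : ℝ) / 4 - i) := by
    induction k with
    | zero => simp
    | succ k ih => rw [Finset.prod_range_succ, Finset.prod_range_succ, ih]; ring
  rw [h4]
  generalize ∏ i ∈ Finset.range k, ((n : ℝ) / 4 - i) = P
  rw [mul_zero, add_zero, Real.one_rpow, div_pow]
  field_simp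

theorem NormalAmbientSpace.volumeCoeff_of_einstein {φ : M → ℝ} (hg : IsEinstein g (κ / 2))
    (hφ : φ = fun _ => c) (B : NormalAmbientSpace g φ) (k : ℕ) (x : M) :
    B.volumeCoeff k x =
      (κ / 4) ^ k / (k.factorial : ℝ) * ∏ i ∈ Finset.range k, ((n : ℝ) - 4 * i) := by
  subst hφ
  rw [B.volumeCoeff_eq (einsteinAmbient hg c), volumeCoeff_einsteinAmbient]

theorem IsEinstein.scaleMetric {r : ℝ} (hg : IsEinstein g r) {s : ℝ} (hs : 0 < s) :
    IsEinstein (scaleMetric g s hs) (r / s) := by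
  intro p y hy X Y
  have e : coordMetric (WeightedAmbient.scaleMetric g s hs) p = fun y => s • coordMetric g p y :=
    funext fun y => coordMetric_scaleMetric g hs p y
  rw [e, ricci_smul ?_ hs.ne', hg p y hy]
  · simp
    field_simp
  · filter_upwards [(isOpen_extChartAt_target p).mem_nhds hy] with x hx
    exact coordMetric_isInvertible g hx

theorem scalarCurvature_of_einstein {r : ℝ} (hg : IsEinstein g r) {p : M} {y : Euc n}
    (hy : y ∈ (extChartAt (𝓡 n) p).target) : scalarCurvature (coordMetric g p) y = n * r := by
  rw [scalarCurvature, metricTrace_smul (coordMetric_isInvertible g hy) r (hg p y hy),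
    finrank_euclideanSpace_fin]

section

variable {V : Type*} [NormedAddCommGroup V] [NormedSpace ℝ V]

theorem hessian_const (G : V → Bil V) (c : ℝ) (x : V) : hessian G (fun _ => c) x = 0 := by
  ext X Y
  rw [hessian_apply]
  have : fderiv ℝ (fun _ : V => c) = 0 := by ext1 x; simp
  simp [this]

theorem laplacian_const [FiniteDimensional ℝ V] (G : V → Bil V) (c : ℝ) (x : V) :
    laplacian G (fun _ => c) x = 0 := by
  simp [laplacian, hessian_const, metricTrace]

theorem gradSq_const (G : V → Bil V) (c : ℝ) (x : V) : gradSq G (fun _ => c) x = 0 := by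
  simp [gradSq]

end

theorem vOne_of_einstein {r : ℝ} (hg : IsEinstein g r) (c : ℝ) (x : M) :
    vOne g (fun _ => c) x = n * r / 2 := by
  have : coordFun (n := n) (fun _ : M => c) x = fun _ => c := rfl
  rw [vOne, weightedScalar, this, laplacian_const, gradSq_const,
    scalarCurvature_of_einstein hg (mem_extChartAt_target (I := 𝓡 n) x)]
  ring

namespace NormalAmbientSpace

/-- The ambient space is the explicit one with `g_u = (1 + κ u) g`. -/
structure IsExplicit (A : NormalAmbientSpace g (fun _ => c)) (κ : ℝ) : Prop where
  pos : ∀ u ∈ A.dom, 0 < 1 + κ * u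
  metric_eq : ∀ u (hu : u ∈ A.dom), A.metric u = scaleMetric g (1 + κ * u) (pos u hu)
  potential_eq : ∀ u ∈ A.dom, A.potential u = einsteinPotential M n κ c u

theorem einsteinAmbient_isExplicit (hg : IsEinstein g (κ / 2)) (c : ℝ) :
    (einsteinAmbient hg c).IsExplicit κ :=
  ⟨fun _ hu => hu, fun _ hu => einsteinMetric_of_pos g hu, fun _ _ => rfl⟩

/-- Uniqueness of analytic normal ambient spaces over an Einstein metric. -/
theorem IsAnalytic.isExplicit [Nonempty M] (hn : 0 < n) (hg : IsEinstein g (κ / 2))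
    {A : NormalAmbientSpace g (fun _ => c)} (hA : A.IsAnalytic) : A.IsExplicit κ := by
  have hev : ∀ᶠ u in 𝓝 (0 : ℝ), 0 < 1 + κ * u := eventually_one_add_mul_pos κ
  have hmet : ∀ u ∈ A.dom, ∀ x : M, ∀ X Y : TangentSpace (𝓡 n) x,
      (A.metric u).inner x X Y = (1 + κ * u) * g.inner x X Y := by
    intro u hu x
    refine inner_eq_of_coordMetric fun X Y => ?_
    set y := extChartAt (𝓡 n) x x with hy
    have hyt := mem_extChartAt_target (I := 𝓡 n) x
    refine AnalyticOnNhd.eqOn_of_isBigO_pow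
      (f := fun u => coordMetric (A.metric u) x y X Y)
      (g := fun u => (1 + κ * u) * coordMetric g x y X Y)
      ((hA _).1 _ _) (fun u _ => by fun_prop) A.ordConnected_dom A.zero_mem_dom (fun m => ?_) hu
    have h1 := (jetEq A (einsteinAmbient hg c) m hyt).1.comp (Φ := fun b => b X Y) (by fun_prop)
    refine h1.2.2.congr' ?_ EventuallyEq.rfl
    filter_upwards [hev] with u hu
    change coordMetric (A.metric u) x y X Y - coordMetric (einsteinMetric g κ u) x y X Y = _
    rw [coordMetric_einsteinMetric g hu]
    rfl
  -- Both `g_u` and `g` are positive on a nonzero tangent vector; such a vector exists because `0 <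
  -- n` and `M` is nonempty.
  have hpos : ∀ u ∈ A.dom, 0 < 1 + κ * u := by
    intro u hu
    obtain ⟨x⟩ := ‹Nonempty M›
    have hX : (EuclideanSpace.single ⟨0, hn⟩ (1 : ℝ) : Euc n) ≠ 0 := by simp
    have h1 := (A.metric u).pos x (EuclideanSpace.single ⟨0, hn⟩ (1 : ℝ) : Euc n) hX
    have h2 := h1.trans_eq (hmet u hu x _ _)
    exact pos_of_mul_pos_left h2 (g.pos x _ hX).le
  refine ⟨hpos, fun u hu => metric_ext fun x X Y => hmet u hu x X Y, fun u hu => ?_⟩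
  funext x
  have hyt := mem_extChartAt_target (I := 𝓡 n) x
  refine AnalyticOnNhd.eqOn_of_isBigO_pow (f := fun u => A.potential u x)
    (g := fun u => einsteinPotential M n κ c u x) (hA x).2
    (analyticOnNhd_log_one_add_mul κ _ c hpos) A.ordConnected_dom A.zero_mem_dom (fun m => ?_) hu
  have h1 := (jetEq A (einsteinAmbient hg c) m hyt).2.2.2
  simp only [coordFun, extChartAt_to_inv] at h1
  exact h1

variable {A : NormalAmbientSpace g (fun _ => c)} {w : ℝ → M → ℝ}

theorem isOpen_times (A : NormalAmbientSpace g (fun _ => c)) : IsOpen A.times :=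
  A.isOpen_dom.preimage continuous_neg

theorem zero_mem_times (A : NormalAmbientSpace g (fun _ => c)) : (0 : ℝ) ∈ A.times := by
  simpa [times] using A.zero_mem_dom

theorem isPreconnected_times (A : NormalAmbientSpace g (fun _ => c)) : IsPreconnected A.times := by
  refine Set.OrdConnected.isPreconnected (Set.ordConnected_def.2 fun a ha b hb t ht => ?_)
  exact A.ordConnected_dom.out hb ha ⟨neg_le_neg ht.2, neg_le_neg ht.1⟩

theorem IsExplicit.vOne_eq (hg : IsEinstein g (κ / 2)) (hA : A.IsExplicit κ) {u : ℝ}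
    (hu : u ∈ A.dom) (x : M) :
    vOne (A.metric u) (A.potential u) x = (n : ℝ) / 4 * (κ / (1 + κ * u)) := by
  have := (hA.pos u hu).ne'
  rw [hA.metric_eq u hu, hA.potential_eq u hu]
  refine (vOne_of_einstein (hg.scaleMetric _) _ x).trans ?_
  field_simp
  ring

theorem hasDerivAt_log_one_sub_mul {t : ℝ} (ht : 0 < 1 + κ * -t) (a c : ℝ) :
    HasDerivAt (fun t => a * Real.log (1 + κ * -t) + c) (-(a * (κ / (1 + κ * -t)))) t := by
  have h1 : HasDerivAt (fun t => 1 + κ * -t) (-κ) t := by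
    simpa using (((hasDerivAt_id t).neg).const_mul κ).const_add 1
  refine (((h1.log ht.ne').const_mul a).add_const c).congr_deriv ?_
  ring

/-- The explicit integral curves. -/
theorem IsExplicit.isIntegralFlow (hg : IsEinstein g (κ / 2)) (hA : A.IsExplicit κ) :
    -- The `+ 0` matches the form `a * log + c` of `hasDerivAt_log_one_sub_mul`.
    A.IsIntegralFlow fun t _ => -((n : ℝ) / 4) * Real.log (1 + κ * -t) + 0 := by
  refine ⟨fun x => by simp, fun t ht x => ?_⟩
  refine (hasDerivAt_log_one_sub_mul (hA.pos _ ht) _ _).congr_deriv ?_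
  rw [hA.vOne_eq hg ht]
  ring

/-- Two functions on an interval with equal derivatives and equal value at `0` coincide; the
velocity does not involve `w`. -/
theorem IsExplicit.integralFlow_eq (hg : IsEinstein g (κ / 2)) (hA : A.IsExplicit κ)
    (hw : A.IsIntegralFlow w) {t : ℝ} (ht : t ∈ A.times) (x : M) :
    w t x = -((n : ℝ) / 4) * Real.log (1 + κ * -t) := by
  have h1 := hA.isIntegralFlow hg
  have := A.isOpen_times.eqOn_of_deriv_eq A.isPreconnected_times
    (f := fun t => w t x) (g := fun t => -((n : ℝ) / 4) * Real.log (1 + κ * -t) + 0)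
    (fun s hs => (hw.2 s hs x).differentiableAt.differentiableWithinAt)
    (fun s hs => (h1.2 s hs x).differentiableAt.differentiableWithinAt)
    (fun s hs => by rw [(hw.2 s hs x).deriv, (h1.2 s hs x).deriv]) A.zero_mem_times
    (by simp [hw.1]) ht
  simpa using this

/-- The coefficient doubles from `n/4` to `n/2` because `-w` contributes the same logarithm as
`φ_u`. -/
theorem IsExplicit.flowPotential_eq (hg : IsEinstein g (κ / 2)) (hA : A.IsExplicit κ)
    (hw : A.IsIntegralFlow w) {t : ℝ} (ht : t ∈ A.times) :
    A.flowPotential w t = fun _ => (n : ℝ) / 2 * Real.log (1 + κ * -t) + c := by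
  funext x
  rw [flowPotential, hA.potential_eq _ ht, hA.integralFlow_eq hg hw ht, einsteinPotential]
  ring

theorem IsExplicit.isEinstein_flowMetric (hg : IsEinstein g (κ / 2)) (hA : A.IsExplicit κ)
    {t : ℝ} (ht : t ∈ A.times) : IsEinstein (A.flowMetric t) (κ / (1 + κ * -t) / 2) := by
  rw [flowMetric, hA.metric_eq _ ht]
  have := hg.scaleMetric (hA.pos _ ht)
  rwa [div_right_comm] at this

theorem IsExplicit.coordMetric_flowMetric (hA : A.IsExplicit κ) {t : ℝ} (ht : t ∈ A.times) (p : M)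
    (y : Euc n) : coordMetric (A.flowMetric t) p y = (1 + κ * -t) • coordMetric g p y := by
  rw [flowMetric, hA.metric_eq _ ht, coordMetric_scaleMetric]

/-- The Ricci tensor of `(1 - κt) g` is always `(κ/2) g`, so the metric moves linearly. The
potential is constant in space, and its time derivative is `-R = -nκ / (2(1 - κt))`. -/
theorem IsExplicit.isGradientRicciFlow (hg : IsEinstein g (κ / 2)) (hA : A.IsExplicit κ)
    (hw : A.IsIntegralFlow w) : IsGradientRicciFlow A.times A.flowMetric (A.flowPotential w) := by
  constructor
  · refine isSmoothFamily_of_scaled (g := g) (a := fun t => 1 + κ * -t)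
      (b := fun t => (n : ℝ) / 2 * Real.log (1 + κ * -t) + c) (by fun_prop) ?_
      (fun t ht p y _ => hA.coordMetric_flowMetric ht p y)
      (fun t ht x => by rw [hA.flowPotential_eq hg hw ht])
    exact (contDiffOn_log_one_add_mul κ ((n : ℝ) / 2) c).comp contDiff_neg.contDiffOn
      fun t ht => hA.pos _ ht
  · intro t ht p y hy
    have hE := hA.isEinstein_flowMetric hg ht
    have ha := (hA.pos _ ht).ne'
    have hc : coordFun (n := n) (A.flowPotential w t) p =
        fun _ => (n : ℝ) / 2 * Real.log (1 + κ * -t) + c := by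
      rw [hA.flowPotential_eq hg hw ht]; rfl
    have hnh := A.isOpen_times.mem_nhds ht
    constructor
    · intro X Y
      rw [weightedRicci, hc, hessian_const, add_zero, hE p y hy, hA.coordMetric_flowMetric ht]
      have h1 : HasDerivAt (fun s => (1 + κ * -s) * coordMetric g p y X Y)
          (-κ * coordMetric g p y X Y) t := by
        have h2 : HasDerivAt (fun t => 1 + κ * -t) (-κ) t := by
          simpa using (((hasDerivAt_id t).neg).const_mul κ).const_add 1
        exact h2.mul_const _
      have e : (fun s => coordMetric (A.flowMetric s) p y X Y) =ᶠ[𝓝 t]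
          fun s => (1 + κ * -s) * coordMetric g p y X Y := by
        filter_upwards [hnh] with s hs
        rw [hA.coordMetric_flowMetric hs]; rfl
      refine (h1.congr_of_eventuallyEq e).congr_deriv ?_
      change -κ * coordMetric g p y X Y =
        -2 * (κ / (1 + κ * -t) / 2 * ((1 + κ * -t) * coordMetric g p y X Y))
      generalize 1 + κ * -t = s at ha ⊢
      field_simp
    · rw [hc, laplacian_const, scalarCurvature_of_einstein hE hy]
      have e : (fun s => coordFun (n := n) (A.flowPotential w s) p y) =ᶠ[𝓝 t]
          fun s => (n : ℝ) / 2 * Real.log (1 + κ * -s) + c := by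
        filter_upwards [hnh] with s hs
        rw [hA.flowPotential_eq hg hw hs]; rfl
      refine ((hasDerivAt_log_one_sub_mul (hA.pos _ ht) _ _).congr_of_eventuallyEq e).congr_deriv ?_
      ring

end NormalAmbientSpace

end EinsteinFlow
end WeightedAmbient

namespace WeightedAmbient

open Filter Topology MeasureTheory

/-! ### The Riemannian volume: scaling, finiteness and positivity -/

section RiemannianVolume

set_option maxSynthPendingDepth 3

variable {n : ℕ} {M : Type*} [TopologicalSpace M] [ChartedSpace (Euc n) M] [IsManifold (𝓡 n) ∞ M]

theorem gramDet_continuousOn (g : Metric n M) (p : M) :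
    ContinuousOn (gramDet g p) (extChartAt (𝓡 n) p).target := by
  have h := bilDet_contDiff.continuous.comp_continuousOn (coordMetric_contDiffOn g p).continuousOn
  exact h.congr fun y _ => gramDet_eq_bilDet g p y

variable [T2Space M] [SigmaCompactSpace M]

/-- The density of the part of the Riemannian volume carried by the chart at `p`. -/
noncomputable def volumeDensity (g : Metric n M) (p : M) (y : Euc n) : ℝ :=
  chartPartition n M p ((extChartAt (𝓡 n) p).symm y) * √(gramDet g p y)

theorem volumeDensity_continuousOn (g : Metric n M) (p : M) :
    ContinuousOn (volumeDensity g p) (extChartAt (𝓡 n) p).target :=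
  ((chartPartition n M p).contMDiff.continuous.comp_continuousOn (continuousOn_extChartAt_symm p)).mul
    (gramDet_continuousOn g p).sqrt

/-- The part of the Riemannian volume carried by the chart at `p`. -/
noncomputable def chartVolume [MeasurableSpace M] (g : Metric n M) (p : M) : Measure M :=
  (((volume : Measure (Euc n)).restrict (extChartAt (𝓡 n) p).target).withDensity fun y =>
    ENNReal.ofReal (volumeDensity g p y)).map (extChartAt (𝓡 n) p).symm

theorem riemannianVolume_eq_sum [MeasurableSpace M] (g : Metric n M) :
    riemannianVolume g = Measure.sum (chartVolume g) := rfl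

theorem riemannianVolume_scaleMetric [MeasurableSpace M] (g : Metric n M) {s : ℝ} (hs : 0 < s) :
    riemannianVolume (scaleMetric g s hs) = ENNReal.ofReal √(s ^ n) • riemannianVolume g := by
  have h (p : M) : chartVolume (scaleMetric g s hs) p =
      ENNReal.ofReal √(s ^ n) • chartVolume g p := by
    have e : (fun y => ENNReal.ofReal (volumeDensity (scaleMetric g s hs) p y)) =
        ENNReal.ofReal √(s ^ n) • fun y => ENNReal.ofReal (volumeDensity g p y) := by
      funext y
      rw [Pi.smul_apply, smul_eq_mul, ← ENNReal.ofReal_mul (Real.sqrt_nonneg _), volumeDensity,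
        volumeDensity, gramDet_scaleMetric, Real.sqrt_mul (by positivity)]
      congr 1
      ring
    rw [chartVolume, e, withDensity_smul' _ _ ENNReal.ofReal_ne_top, Measure.map_smul, chartVolume]
  rw [riemannianVolume_eq_sum, riemannianVolume_eq_sum]
  ext t ht
  rw [Measure.smul_apply, Measure.sum_apply _ ht, Measure.sum_apply _ ht, smul_eq_mul,
    ← ENNReal.tsum_mul_left]
  simp [h]

variable [MeasurableSpace M] [BorelSpace M]

theorem chartVolume_univ (g : Metric n M) (p : M) : chartVolume g p Set.univ =
    ∫⁻ y in (extChartAt (𝓡 n) p).target, ENNReal.ofReal (volumeDensity g p y) := by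
  have hm : AEMeasurable (extChartAt (𝓡 n) p).symm
      ((volume : Measure (Euc n)).restrict (extChartAt (𝓡 n) p).target) :=
    (continuousOn_extChartAt_symm p).aemeasurable (isOpen_extChartAt_target p).measurableSet
  rw [chartVolume, Measure.map_apply_of_aemeasurable
    (hm.mono_ac (withDensity_absolutelyContinuous _ _)) MeasurableSet.univ, Set.preimage_univ,
    withDensity_apply _ MeasurableSet.univ, Measure.restrict_univ]

/-- The density vanishes off the chart image of the support of the partition function. That image is
compact as `M` is, and the density is continuous on it. -/
theorem chartVolume_univ_lt_top [CompactSpace M] (g : Metric n M) (p : M) :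
    chartVolume g p Set.univ < ⊤ := by
  set T := (extChartAt (𝓡 n) p).target
  have hS : tsupport (chartPartition n M p) ⊆ (extChartAt (𝓡 n) p).source := by
    rw [extChartAt_source]
    exact chartPartition_subordinate n M p
  set K := extChartAt (𝓡 n) p '' tsupport (chartPartition n M p)
  have hKc : IsCompact K :=
    (isClosed_tsupport _).isCompact.image_of_continuousOn ((continuousOn_extChartAt p).mono hS)
  have hKT : K ⊆ T := by
    rintro _ ⟨x, hx, rfl⟩
    exact (extChartAt (𝓡 n) p).map_source (hS hx)
  have hz : ∀ y ∈ T, y ∉ K → volumeDensity g p y = 0 := by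
    intro y hy hyK
    rw [volumeDensity, mul_eq_zero]
    refine Or.inl (image_eq_zero_of_notMem_tsupport fun h => hyK ⟨_, h, ?_⟩)
    exact (extChartAt (𝓡 n) p).right_inv hy
  have hint := ((volumeDensity_continuousOn g p).mono hKT).integrableOn_compact (μ := volume) hKc
  rw [chartVolume_univ]
  calc ∫⁻ y in T, ENNReal.ofReal (volumeDensity g p y)
      = ∫⁻ y in T, K.indicator (fun y => ENNReal.ofReal (volumeDensity g p y)) y := by
        refine setLIntegral_congr_fun (isOpen_extChartAt_target p).measurableSet fun y hy => ?_
        by_cases hyK : y ∈ K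
        · simp [hyK]
        · simp [hyK, hz y hy hyK]
    _ ≤ ∫⁻ y, K.indicator (fun y => ENNReal.ofReal (volumeDensity g p y)) y :=
        setLIntegral_le_lintegral _ _
    _ = ∫⁻ y in K, ENNReal.ofReal (volumeDensity g p y) := lintegral_indicator hKc.measurableSet _
    _ < ⊤ := hint.lintegral_lt_top

/-- By compactness and local finiteness only finitely many members of the partition are nonzero. -/
theorem isFiniteMeasure_riemannianVolume [CompactSpace M] (g : Metric n M) :
    IsFiniteMeasure (riemannianVolume g) := by
  refine ⟨?_⟩
  rw [riemannianVolume_eq_sum, Measure.sum_apply _ MeasurableSet.univ]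
  have hf := (chartPartition n M).locallyFinite.finite_nonempty_of_compact
  rw [tsum_eq_sum (s := hf.toFinset) fun p hp => ?_]
  · exact ENNReal.sum_lt_top.2 fun p _ => chartVolume_univ_lt_top g p
  · have h0 : ⇑(chartPartition n M p) = 0 := by
      rw [Set.Finite.mem_toFinset, Set.mem_ofPred_eq, Set.not_nonempty_iff_eq_empty] at hp
      exact Function.support_eq_empty_iff.1 hp
    simp [chartVolume_univ, volumeDensity, h0]

/-- Some member of the partition is positive at a given point, so its density is positive on a
nonempty open set of the chart target. -/
theorem riemannianVolume_univ_ne_zero [Nonempty M] (g : Metric n M) :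
    riemannianVolume g Set.univ ≠ 0 := by
  obtain ⟨x⟩ := ‹Nonempty M›
  obtain ⟨p, hp⟩ := (chartPartition n M).exists_pos_of_mem (Set.mem_univ x)
  have hx : x ∈ (extChartAt (𝓡 n) p).source := by
    rw [extChartAt_source]
    exact chartPartition_subordinate n M p (subset_tsupport _ hp.ne')
  set T := (extChartAt (𝓡 n) p).target
  have hT : IsOpen T := isOpen_extChartAt_target p
  have hc := volumeDensity_continuousOn g p
  have hopen : IsOpen (T ∩ volumeDensity g p ⁻¹' Set.Ioi 0) := hc.isOpen_inter_preimage hT isOpen_Ioi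
  have hne : (T ∩ volumeDensity g p ⁻¹' Set.Ioi 0).Nonempty := by
    have hy := (extChartAt (𝓡 n) p).map_source hx
    refine ⟨extChartAt (𝓡 n) p x, hy, mul_pos ?_ (Real.sqrt_pos.2 (gramDet_pos g hy))⟩
    rwa [(extChartAt (𝓡 n) p).left_inv hx]
  rw [riemannianVolume_eq_sum, Ne, Measure.sum_apply_eq_zero' MeasurableSet.univ]
  intro h
  have hp0 := h p
  rw [chartVolume_univ, lintegral_eq_zero_iff'
    (hc.aemeasurable hT.measurableSet).ennreal_ofReal, EventuallyEq, ae_restrict_iff' hT.measurableSet,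
    ae_iff] at hp0
  refine (hopen.measure_pos volume hne).ne' (measure_mono_null ?_ hp0)
  rintro y ⟨hy, hpos⟩ h
  exact (ENNReal.ofReal_pos.2 hpos).ne' (h hy)

theorem riemannianVolume_real_pos [CompactSpace M] [Nonempty M] (g : Metric n M) :
    0 < (riemannianVolume g).real Set.univ := by
  have := isFiniteMeasure_riemannianVolume g
  exact ENNReal.toReal_pos (riemannianVolume_univ_ne_zero g) (measure_ne_top _ _)

end RiemannianVolume
end WeightedAmbient

namespace WeightedAmbient

open Filter Topology MeasureTheory

/-! ### Signs of the products and monotonicity of the functionals -/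

section Monotonicity

theorem prod_sub_four_mul_pos {n k : ℕ} (h : ∀ i < k, 4 * i < n) :
    0 < ∏ i ∈ Finset.range k, ((n : ℝ) - 4 * i) :=
  Finset.prod_pos fun i hi => sub_pos.2 (by exact_mod_cast h i (Finset.mem_range.1 hi))

theorem prod_sub_four_mul_eq_zero {j k : ℕ} (h : j < k) :
    ∏ i ∈ Finset.range k, (((4 * j : ℕ) : ℝ) - 4 * i) = 0 :=
  Finset.prod_eq_zero (Finset.mem_range.2 h) (by push_cast; ring)

theorem sub_four_mul_neg {n k : ℕ} (h : n < 4 * k) : (n : ℝ) - 4 * k < 0 :=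
  sub_neg.2 (by exact_mod_cast h)

/-- The first `j` factors are positive and all later ones negative, so adding two factors preserves
the sign. -/
theorem prod_sub_four_mul_add_two_mul_pos {n j : ℕ} (h1 : ∀ i < j, 4 * i < n) (h2 : n < 4 * j)
    (s : ℕ) : 0 < ∏ i ∈ Finset.range (j + 2 * s), ((n : ℝ) - 4 * i) := by
  induction s with
  | zero => exact prod_sub_four_mul_pos h1
  | succ s ih =>
    rw [show j + 2 * (s + 1) = j + 2 * s + 1 + 1 by ring, Finset.prod_range_succ,
      Finset.prod_range_succ]
    exact mul_pos_of_neg_of_neg (mul_neg_of_pos_of_neg ih (sub_four_mul_neg (by omega)))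
      (sub_four_mul_neg (by omega))

theorem prod_sub_four_mul_add_odd_neg {n j : ℕ} (h1 : ∀ i < j, 4 * i < n) (h2 : n < 4 * j)
    (s : ℕ) : ∏ i ∈ Finset.range (j + 2 * s + 1), ((n : ℝ) - 4 * i) < 0 := by
  rw [Finset.prod_range_succ]
  exact mul_neg_of_pos_of_neg (prod_sub_four_mul_add_two_mul_pos h1 h2 s)
    (sub_four_mul_neg (by omega))

variable {n : ℕ} {M : Type*} [TopologicalSpace M] [ChartedSpace (Euc n) M] [IsManifold (𝓡 n) ∞ M]
variable {g : Metric n M} {κ c : ℝ}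

namespace NormalAmbientSpace

variable {A : NormalAmbientSpace g (fun _ => c)} {w : ℝ → M → ℝ}

theorem IsExplicit.nonempty_normalAmbientSpace (hg : IsEinstein g (κ / 2)) (hA : A.IsExplicit κ)
    (hw : A.IsIntegralFlow w) {t : ℝ} (ht : t ∈ A.times) :
    Nonempty (NormalAmbientSpace (A.flowMetric t) (A.flowPotential w t)) := by
  rw [hA.flowPotential_eq hg hw ht]
  exact ⟨einsteinAmbient (hA.isEinstein_flowMetric hg ht) _⟩

theorem IsExplicit.volumeCoeff_eq (hg : IsEinstein g (κ / 2)) (hA : A.IsExplicit κ)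
    (hw : A.IsIntegralFlow w) {t : ℝ} (ht : t ∈ A.times)
    (B : NormalAmbientSpace (A.flowMetric t) (A.flowPotential w t)) (k : ℕ) (x : M) :
    B.volumeCoeff k x = (κ / (1 + κ * -t) / 4) ^ k / (k.factorial : ℝ) *
      ∏ i ∈ Finset.range k, ((n : ℝ) - 4 * i) :=
  B.volumeCoeff_of_einstein (hA.isEinstein_flowMetric hg ht) (hA.flowPotential_eq hg hw ht) k x

/-- The factor `(1 - κt)^(n/2)` of the volume cancels that of `e^{-φ_t}`, so time enters only
through the `k`-th power. -/
theorem IsExplicit.functional_eq [T2Space M] [SigmaCompactSpace M] [MeasurableSpace M]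
    (hg : IsEinstein g (κ / 2)) (hA : A.IsExplicit κ) (hw : A.IsIntegralFlow w) {t : ℝ}
    (ht : t ∈ A.times) (B : NormalAmbientSpace (A.flowMetric t) (A.flowPotential w t)) (k : ℕ) :
    B.functional k = (κ / (1 + κ * -t) / 4) ^ k *
      ((∏ i ∈ Finset.range k, ((n : ℝ) - 4 * i)) *
        (Real.exp (-c) * (riemannianVolume g).real Set.univ / (k.factorial : ℝ))) := by
  have ha := hA.pos _ ht
  have he := exp_mul_sqrt_pow ha ((n : ℝ) / 2) n
  rw [sub_self, Real.rpow_zero] at he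
  have hv : (riemannianVolume (A.flowMetric t)).real Set.univ =
      √((1 + κ * -t) ^ n) * (riemannianVolume g).real Set.univ := by
    rw [flowMetric, hA.metric_eq _ ht, riemannianVolume_scaleMetric, measureReal_ennreal_smul_apply,
      ENNReal.toReal_ofReal (Real.sqrt_nonneg _)]
  simp only [functional, hA.volumeCoeff_eq hg hw ht, hA.flowPotential_eq hg hw ht]
  rw [integral_const, smul_eq_mul, hv, neg_add, Real.exp_add]
  linear_combination (riemannianVolume g).real Set.univ * ((κ / (1 + κ * -t) / 4) ^ k /
    (k.factorial : ℝ) * ∏ i ∈ Finset.range k, ((n : ℝ) - 4 * i)) * Real.exp (-c) * he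

theorem IsExplicit.strictMono_pow (hκ : 0 < κ) (hA : A.IsExplicit κ) {k : ℕ} (hk : 1 ≤ k) :
    StrictMono fun t : A.times => (κ / (1 + κ * -(t : ℝ)) / 4) ^ k := by
  intro s t hst
  have hs := hA.pos _ s.2
  have ht := hA.pos _ t.2
  have h : (s : ℝ) < t := hst
  refine pow_lt_pow_left₀ ?_ (by positivity) (by omega)
  gcongr

theorem IsExplicit.functional_monotonicity [T2Space M] [CompactSpace M] [Nonempty M]
    [MeasurableSpace M] [BorelSpace M] (hκ : 0 < κ) (hg : IsEinstein g (κ / 2))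
    (hA : A.IsExplicit κ) (hw : A.IsIntegralFlow w)
    (B : (t : A.times) → NormalAmbientSpace (A.flowMetric t) (A.flowPotential w t)) {k : ℕ}
    (hk : 1 ≤ k) :
    (0 < ∏ i ∈ Finset.range k, ((n : ℝ) - 4 * i) → StrictMono fun t => (B t).functional k) ∧
    (∏ i ∈ Finset.range k, ((n : ℝ) - 4 * i) < 0 → StrictAnti fun t => (B t).functional k) ∧
    (∏ i ∈ Finset.range k, ((n : ℝ) - 4 * i) = 0 → ∀ t, (B t).functional k = 0) := by
  have hC : 0 < Real.exp (-c) * (riemannianVolume g).real Set.univ / (k.factorial : ℝ) := by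
    have := riemannianVolume_real_pos g
    positivity
  have hm := hA.strictMono_pow hκ hk
  have e (t : A.times) := hA.functional_eq hg hw t.2 (B t) k
  refine ⟨fun h => ?_, fun h s t hst => ?_, fun h t => by rw [e, h, zero_mul, mul_zero]⟩
  · simp only [e]
    exact hm.mul_const (mul_pos h hC)
  · simp only [e]
    exact mul_lt_mul_of_neg_right (hm hst) (mul_neg_of_neg_of_pos h hC)

end NormalAmbientSpace
end Monotonicity
end WeightedAmbient

/-! ### The main theorem -/

theorem theorem1p8 {n : ℕ} (hn : 3 ≤ n) {M : Type*} [TopologicalSpace M] [T2Space M]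
    [CompactSpace M] [ConnectedSpace M] [ChartedSpace (Euc n) M] [IsManifold (𝓡 n) ∞ M]
    [MeasurableSpace M] [BorelSpace M]
    (g : Metric n M) (μ c : ℝ) (hμ : 0 < μ) (hg : IsEinstein g (2 * μ)) :
    -- the global normal ambient space and the flow of the vector field exist
    (∃ A : NormalAmbientSpace g (fun _ => c), A.IsAnalytic ∧ A.IsGlobal ∧
      A.dom = Set.Ioi (-(1 / (4 * μ))) ∧ ∃ w, A.IsIntegralFlow w) ∧
    ∀ A : NormalAmbientSpace g (fun _ => c), A.IsAnalytic →
      -- the ambient metric is the explicit one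
      (∀ u ∈ A.dom, 0 < 1 + 4 * μ * u ∧
        (∀ (x : M) (X Y : TangentSpace (𝓡 n) x),
          (A.metric u).inner x X Y = (1 + 4 * μ * u) * g.inner x X Y) ∧
        ∀ x : M, A.potential u x = (n : ℝ) / 4 * Real.log |1 + 4 * μ * u| + c) ∧
      ∀ w : ℝ → M → ℝ, A.IsIntegralFlow w →
        -- along the vector field one has the gradient Ricci flow that starts at `(g, c)`
        (IsGradientRicciFlow A.times A.flowMetric (A.flowPotential w) ∧
          A.flowMetric 0 = g ∧ A.flowPotential w 0 = fun _ => c) ∧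
        -- the structure at each time has a normal ambient space
        (∀ t : A.times, Nonempty (NormalAmbientSpace (A.flowMetric t) (A.flowPotential w t))) ∧
        -- the functionals, computed from any normal ambient spaces
        ∀ B : (t : A.times) → NormalAmbientSpace (A.flowMetric t) (A.flowPotential w t),
          (∀ (t : A.times) (k : ℕ) (x : M), (B t).volumeCoeff k x =
            (μ / (1 - 4 * μ * t)) ^ k / (Nat.factorial k : ℝ) *
              ∏ i ∈ Finset.range k, ((n : ℝ) - 4 * i)) ∧
          (∀ k : ℕ, 1 ≤ k →
            (0 < ∏ i ∈ Finset.range k, ((n : ℝ) - 4 * i) →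
              StrictMono fun t => (B t).functional k) ∧
            (∏ i ∈ Finset.range k, ((n : ℝ) - 4 * i) < 0 →
              StrictAnti fun t => (B t).functional k) ∧
            (∏ i ∈ Finset.range k, ((n : ℝ) - 4 * i) = 0 →
              ∀ t, (B t).functional k = 0)) ∧
          ∀ j : ℕ, 1 ≤ j →
            (4 * (j - 1) < n ∧ n < 4 * j →
              (∀ k : ℕ, (1 ≤ k ∧ k ≤ j) ∨ (∃ s : ℕ, 1 ≤ s ∧ k = j + 2 * s) →
                StrictMono fun t => (B t).functional k) ∧
              (∀ k : ℕ, (∃ s : ℕ, 1 ≤ s ∧ k = j + 2 * s - 1) →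
                StrictAnti fun t => (B t).functional k)) ∧
            (n = 4 * j →
              (∀ k : ℕ, 1 ≤ k ∧ k ≤ j → StrictMono fun t => (B t).functional k) ∧
              (∀ k : ℕ, j < k → ∀ t, (B t).functional k = 0)) := by
  -- All previous results apply with `κ = 4μ`.
  have hg' : IsEinstein g (4 * μ / 2) := by rwa [show 4 * μ / 2 = 2 * μ by ring]
  have hκ : 0 < 4 * μ := by positivity
  refine ⟨⟨einsteinAmbient hg' c, einsteinAmbient_isAnalytic hg' c, einsteinAmbient_isGlobal hg' c,
    ?_, _, (NormalAmbientSpace.einsteinAmbient_isExplicit hg' c).isIntegralFlow hg'⟩, ?_⟩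
  · ext u
    change 0 < 1 + 4 * μ * u ↔ -(1 / (4 * μ)) < u
    have : 4 * μ * (1 / (4 * μ) + u) = 1 + 4 * μ * u := by field_simp
    rw [neg_lt_iff_pos_add', ← this, mul_pos_iff_of_pos_left hκ]
  intro A hA
  have hE := hA.isExplicit (by omega) hg'
  refine ⟨fun u hu => ⟨hE.pos u hu, fun x X Y => ?_, fun x => ?_⟩, fun w hw => ?_⟩
  · rw [hE.metric_eq u hu]
    rfl
  · rw [hE.potential_eq u hu, abs_of_pos (hE.pos u hu)]
    rfl
  have h0 : ∀ x, w 0 x = 0 := hw.1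
  refine ⟨⟨hE.isGradientRicciFlow hg' hw, ?_, ?_⟩,
    fun t => hE.nonempty_normalAmbientSpace hg' hw t.2, fun B => ?_⟩
  · rw [NormalAmbientSpace.flowMetric, neg_zero, A.metric_zero]
  · funext x
    rw [NormalAmbientSpace.flowPotential, neg_zero, A.potential_zero, h0, sub_zero]
  have hmono := fun (k : ℕ) (hk : 1 ≤ k) => hE.functional_monotonicity hκ hg' hw B hk
  refine ⟨fun t k x => ?_, hmono, fun j hj => ⟨fun ⟨h1, h2⟩ => ⟨?_, ?_⟩, fun h => ⟨?_, ?_⟩⟩⟩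
  · rw [hE.volumeCoeff_eq hg' hw t.2 (B t) k x, div_right_comm, mul_div_cancel_left₀ μ four_ne_zero,
      mul_neg, ← sub_eq_add_neg]
  · rintro k (⟨hk1, hk2⟩ | ⟨s, hs, rfl⟩)
    · exact (hmono k hk1).1 (prod_sub_four_mul_pos fun i hi => by omega)
    · exact (hmono _ (by omega)).1
        (prod_sub_four_mul_add_two_mul_pos (fun i hi => by omega) h2 s)
  · rintro k ⟨s, hs, rfl⟩
    -- Shifting `s` by one turns the truncated `j + 2s - 1` into `j + 2s + 1`, an odd number of
    -- negative factors past `j`.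
    obtain ⟨s, rfl⟩ := Nat.exists_eq_add_of_le hs
    rw [show j + 2 * (1 + s) - 1 = j + 2 * s + 1 by omega]
    exact (hmono _ (by omega)).2.1 (prod_sub_four_mul_add_odd_neg (fun i hi => by omega) h2 s)
  · rintro k ⟨hk1, hk2⟩
    exact (hmono k hk1).1 (prod_sub_four_mul_pos fun i hi => by omega)
  · subst h
    exact fun k hk => (hmono k (by omega)).2.2 (prod_sub_four_mul_eq_zero hk)
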